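/- Let $a<b$ be real, let $k\ge 1$, and let $\{u_0,\dots,u_{2k+1}\}$ be a complete Chebyshev set on $[a,b]$: the $u_j$ are continuous real functions on $[a,b]$ and, for each $1\le n\le 2k+2$, $\det\big(u_i(t_j)\big)_{i,j=0}^{n-1}\neq 0$ whenever $a\le t_0<\dots<t_{n-1}\le b$. Let $w$ be integrable on $[a,b]$ and positive almost everywhere, let $c_j=\int_a^b u_j(t)w(t)\,dt$ and $\mathbf c^{n}=(c_0,\dots,c_{n-1})$. **Definitions.** A *representation* of $\mathbf c^n$ is a finite discrete measure $\sigma=\sum_i\lambda_i\delta_{t_i}$ with distinct *roots* $t_i\in[a,b]$, weights $\lambda_i>0$ and $\sum_i\lambda_iu_j(t_i)=c_j$ for $0\le j<n$. Its *index* is the number of its roots, an endpoint $a$ or $b$ being counted as $\tfrac12$. It is *principal* if its index is $n/2$ and *canonical* if its index is $(n+1)/2$. A principal representation is *upper* if it involves $b$ and *lower* otherwise. A representation is *attached to* $\xi\in[a,b]$ if $\xi$ is one of its roots and it is either principal, or canonical with $\xi\in(a,b)$. The *range* $R(\mathbf c^{n})$ is the set of values $\int_{[a,b]} u_{n}\,d\rho$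 over all finite measures $\rho$ on $[a,b]$ with $\int_{[a,b]} u_j\,d\rho=c_j$ for $0\le j<n$. The set $\{u_j\}$ is *positively oriented* if all the above determinants are positive (which can always be achieved by changing the signs of some of the $u_j$). **Theorem.** 1. *(Start.)* $\mathbf c^{2k}$ has exactly one lower principal representation. It has $k$ roots $a<t_1<\dots<t_k<b$, with weights $\lambda_1,\dots,\lambda_k>0$ (the $k$-point generalized Gauss rule). 2. *(First continuation.)* There are points $x_1(\xi)<\dots<x_{k+1}(\xi)$ and weights $l_1(\xi),\dots,l_{k+1}(\xi)$, continuous in $\xi\in[a,t_1]$, such that $x_1(\xi)=\xi$ and $x_{k+1}(\xi)=b$, and such that for each $\xi\in[a,t_1]$ the measure $\sum_i l_i(\xi)\delta_{x_i(\xi)}$ is the unique representation of $\mathbf c^{2k}$ attached to $\xi$ (a point of weight $0$ is disregarded). For $\xi=t_1$ the points are $t_1,\dots,t_k,b$ and the weights are $\lambda_1,\dots,\lambda_k,0$; for $a\le\xi<t_1$ all weights are positive. The points $x_1,\dots,x_k$ are strictly increasing functions of $\xi$, so they move to the left as $\xi$ decreases. The discrete moment $\mu_{2k}(\xi)=\sum_{i=1}^{k+1}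 l_i(\xi)u_{2k}(x_i(\xi))$ is a strictly monotone function of $\xi\in[a,t_1]$ with image $R(\mathbf c^{2k})$; if $\{u_j\}$ is positively oriented it is a strictly decreasing function of $\xi$. There is exactly one $\xi^*\in[a,t_1]$ with $\mu_{2k}(\xi^*)=c_{2k}$; it satisfies $a<\xi^*<t_1$, and $\sum_i l_i(\xi^*)\delta_{x_i(\xi^*)}$ is the unique upper principal representation of $\mathbf c^{2k+1}$. 3. *(Second continuation.)* There are points $y_1(\xi)<\dots<y_{k+1}(\xi)$ and weights $m_1(\xi),\dots,m_{k+1}(\xi)>0$, continuous in $\xi\in[a,\xi^*]$, equal to the points and weights of 2. at $\xi=\xi^*$, such that $y_1(\xi)=\xi$, $y_{k+1}(\xi)<b$ for $\xi<\xi^*$, and for each $\xi\in[a,\xi^*]$ the measure $\sum_i m_i(\xi)\delta_{y_i(\xi)}$ is the unique representation of $\mathbf c^{2k+1}$ attached to $\xi$. All $y_i$ are strictly increasing functions of $\xi$. The discrete moment $\mu_{2k+1}(\xi)=\sum_{i=1}^{k+1} m_i(\xi)u_{2k+1}(y_i(\xi))$ is a strictly monotone function of $\xi\in[a,\xi^*]$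 with image $R(\mathbf c^{2k+1})$; if $\{u_j\}$ is positively oriented it is a strictly increasing function of $\xi$. There is exactly one $\hat\xi\in[a,\xi^*]$ with $\mu_{2k+1}(\hat\xi)=c_{2k+1}$; it satisfies $a<\hat\xi<\xi^*$, and $\sum_i m_i(\hat\xi)\delta_{y_i(\hat\xi)}$ is the unique lower principal representation of $\mathbf c^{2k+2}$. This is the $(k+1)$-point generalized Gauss rule: its $k+1$ points lie in $(a,b)$, its weights are positive, and $\sum_i m_i(\hat\xi)u_j(y_i(\hat\xi))=\int_a^b u_j(t)w(t)\,dt$ for $0\le j\le 2k+1$. -/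

import Mathlib

open Set MeasureTheory

noncomputable section

/-- The determinant with rows `u 0, …, u (n-1)` and columns the points `t 0, …, t (n-1)`. -/
def chebDet (u : ℕ → ℝ → ℝ) (n : ℕ) (t : Fin n → ℝ) : ℝ :=
  (Matrix.of fun i j : Fin n => u i (t j)).det

/-- `u 0, …, u (n-1)` is a Chebyshev set on `[a, b]`. -/
def IsChebyshevSet (u : ℕ → ℝ → ℝ) (a b : ℝ) (n : ℕ) : Prop :=
  (∀ j < n, ContinuousOn (u j) (Icc a b)) ∧
    ∀ t : Fin n → ℝ, StrictMono t → (∀ i, t i ∈ Icc a b) → chebDet u n t ≠ 0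

/-- `u 0, …, u (N-1)` is a complete Chebyshev set on `[a, b]`: each initial segment is a
Chebyshev set. -/
def IsCompleteChebyshevSet (u : ℕ → ℝ → ℝ) (a b : ℝ) (N : ℕ) : Prop :=
  ∀ n ≤ N, IsChebyshevSet u a b n

/-- The sign normalization of a complete Chebyshev set: all the determinants at increasing points
are positive (this can always be reached by changing the signs of some of the functions). -/
def IsPositivelyOriented (u : ℕ → ℝ → ℝ) (a b : ℝ) (N : ℕ) : Prop :=
  ∀ n ≤ N, ∀ t : Fin n → ℝ, StrictMono t → (∀ i, t i ∈ Icc a b) → 0 < chebDet u n t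

/-- The moments of the weight function `w` on `[a, b]`. -/
def weightMoment (u : ℕ → ℝ → ℝ) (a b : ℝ) (w : ℝ → ℝ) (j : ℕ) : ℝ :=
  ∫ t in a..b, u j t * w t

/-- The discrete measure with mass `l i` at the point `x i`; a finitely supported function
`σ : ℝ →₀ ℝ` stands for the discrete measure with mass `σ t` at `t`, whose roots are `σ.support`. -/
def discreteMeasure {p : ℕ} (x l : Fin p → ℝ) : ℝ →₀ ℝ :=
  ∑ i, Finsupp.single (x i) (l i)

/-- The value `∑ i, l i * f (x i)` of the quadrature rule with points `x` and weights `l`. -/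
def quadSum {p : ℕ} (f : ℝ → ℝ) (x l : Fin p → ℝ) : ℝ :=
  ∑ i, l i * f (x i)

/-- The index of a set of points of `[a, b]`: an endpoint counts for one half. -/
def pointIndex (a b : ℝ) (S : Finset ℝ) : ℝ :=
  ∑ t ∈ S, if t = a ∨ t = b then (1 / 2 : ℝ) else 1

/-- `σ` is a convex representation of the vector `(c 0, …, c (n-1))` of the first `n` moments. -/
structure IsRepresentation (u : ℕ → ℝ → ℝ) (a b : ℝ) (n : ℕ) (c : ℕ → ℝ) (σ : ℝ →₀ ℝ) :
    Prop where
  mem_Icc : ∀ t ∈ σ.support, t ∈ Icc a b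
  pos : ∀ t ∈ σ.support, 0 < σ t
  moment : ∀ j < n, (σ.sum fun t m => m * u j t) = c j

/-- A principal representation of the first `n` moments: one of index `n / 2`. -/
def IsPrincipal (u : ℕ → ℝ → ℝ) (a b : ℝ) (n : ℕ) (c : ℕ → ℝ) (σ : ℝ →₀ ℝ) : Prop :=
  IsRepresentation u a b n c σ ∧ pointIndex a b σ.support = (n : ℝ) / 2

/-- A canonical representation of the first `n` moments: one of index `(n + 1) / 2`. -/
def IsCanonical (u : ℕ → ℝ → ℝ) (a b : ℝ) (n : ℕ) (c : ℕ → ℝ) (σ : ℝ →₀ ℝ) : Prop :=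
  IsRepresentation u a b n c σ ∧ pointIndex a b σ.support = ((n : ℝ) + 1) / 2

/-- The upper principal representation is the one that involves `b`.  By the value of the index
its roots are `a < s₁ < ⋯ < b` for odd `n`, and `a = s₁ < ⋯ < b` for even `n`. -/
def IsUpperPrincipal (u : ℕ → ℝ → ℝ) (a b : ℝ) (n : ℕ) (c : ℕ → ℝ) (σ : ℝ →₀ ℝ) : Prop :=
  IsPrincipal u a b n c σ ∧ b ∈ σ.support

/-- The lower principal representation is the one that does not involve `b`.  By the value of the
index its roots are `a = t₁ < ⋯ < b` for odd `n`, and are all interior for even `n`. -/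
def IsLowerPrincipal (u : ℕ → ℝ → ℝ) (a b : ℝ) (n : ℕ) (c : ℕ → ℝ) (σ : ℝ →₀ ℝ) : Prop :=
  IsPrincipal u a b n c σ ∧ b ∉ σ.support

/-- `σ` is a representation `σ_ξ` of the first `n` moments attached to the point `ξ`: it involves
`ξ`, and it is canonical or principal, but principal if `ξ` is an endpoint. -/
def IsCanonicalAt (u : ℕ → ℝ → ℝ) (a b : ℝ) (n : ℕ) (c : ℕ → ℝ) (ξ : ℝ) (σ : ℝ →₀ ℝ) : Prop :=
  ξ ∈ σ.support ∧
    (IsPrincipal u a b n c σ ∨ (IsCanonical u a b n c σ ∧ ξ ∈ Ioo a b))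

/-- The range of the next moment `∫ u n dσ` over all (finite, nonnegative) measures on `[a, b]`
whose first `n` moments are `c 0, …, c (n-1)`. -/
def momentRange (u : ℕ → ℝ → ℝ) (a b : ℝ) (n : ℕ) (c : ℕ → ℝ) : Set ℝ :=
  {γ | ∃ ρ : Measure ℝ, IsFiniteMeasure ρ ∧ (∀ j < n, ∫ t in Icc a b, u j t ∂ρ = c j) ∧
    ∫ t in Icc a b, u n t ∂ρ = γ}

/-- The points `X ξ` and weights `L ξ` depend continuously on `ξ ∈ [a, β]`, the points are
increasing and start with `ξ`, and for each `ξ` they give the one and only representation of the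
first `n` moments attached to `ξ` (points of weight zero being disregarded). -/
structure IsCanonicalFamily (u : ℕ → ℝ → ℝ) (a b : ℝ) (n : ℕ) (c : ℕ → ℝ) (β : ℝ) {k : ℕ}
    (X L : ℝ → Fin (k + 1) → ℝ) : Prop where
  continuousOn_points : ContinuousOn X (Icc a β)
  continuousOn_weights : ContinuousOn L (Icc a β)
  strictMono : ∀ ξ ∈ Icc a β, StrictMono (X ξ)
  first : ∀ ξ ∈ Icc a β, X ξ 0 = ξ
  canonical_iff : ∀ ξ ∈ Icc a β, ∀ σ : ℝ →₀ ℝ,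
    IsCanonicalAt u a b n c ξ σ ↔ σ = discreteMeasure (X ξ) (L ξ)

end

/-! The basic object is a finite signed discrete measure `d` whose moments against `u 0, …, u (n-1)`
vanish. Testing it against generalized polynomials with prescribed simple zeros gives three facts.
Carried by at most `n` points, `d` is zero (`eq_zero_of_card_le`). Carried by `n + 1` points, it
alternates in sign, and its leftmost mass fixes the sign of its next moment (`exists_alternating`,
`next_moment_sign`). In general, if `d` has a positive mass, its negative part has index at least `n
/ 2` (`le_dblIndex_neg`). For differences of representations this yields uniqueness of the
representation attached to `ξ`, monotone motion of the roots and strict monotonicity of the next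
moment.

Existence comes from convexity, not from solving the moment equations along a path. The cone of
moment vectors is closed, and `c` is strictly positive on nonzero nonnegative polynomials. Moving
from `c` until the cone is left, one meets a boundary point supported by a nonnegative polynomial;
every representation there has its roots among the zeros of that polynomial, and these have small
index (`dblIndex_lt_of_nonneg`, `exists_boundary_point`). Moving against the moment vector of the
unit mass at `ξ` produces the representation attached to `ξ`; moving along the last coordinate
produces principal representations that are extremal for the next moment.

Continuity in `ξ` follows from uniqueness and compactness: a limit of attached representations again
has few roots besides `ξ` (`eq_of_limit`). In each continuation the next moment therefore runs
continuously and strictly monotonically between its values at the upper and the lower principal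
representations, which are the extremes of its range. It takes the prescribed value once, and there
the measure represents one more moment; a count of roots shows that it is principal for the longer
vector. This is applied with `n = 2 * k` and then with `n = 2 * k + 1`. -/

/-- The integral of `f` against the finite signed discrete measure `d`. -/
noncomputable def pairing (d : ℝ →₀ ℝ) (f : ℝ → ℝ) : ℝ := d.sum fun t m => m * f t

theorem pairing_eq_sum {d : ℝ →₀ ℝ} {T : Finset ℝ} (h : d.support ⊆ T) (f : ℝ → ℝ) :
    pairing d f = ∑ t ∈ T, d t * f t :=
  Finsupp.sum_of_support_subset _ h _ (by simp)

theorem pairing_sub (d d' : ℝ →₀ ℝ) (f : ℝ → ℝ) :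
    pairing (d - d') f = pairing d f - pairing d' f :=
  Finsupp.sum_sub_index fun _ _ _ => sub_mul _ _ _

theorem pairing_add (d d' : ℝ →₀ ℝ) (f : ℝ → ℝ) :
    pairing (d + d') f = pairing d f + pairing d' f :=
  Finsupp.sum_add_index' (by simp) fun _ _ _ => add_mul _ _ _

theorem pairing_single (t m : ℝ) (f : ℝ → ℝ) : pairing (Finsupp.single t m) f = m * f t :=
  Finsupp.sum_single_index (by simp)

theorem pairing_smul (r : ℝ) (d : ℝ →₀ ℝ) (f : ℝ → ℝ) :
    pairing (r • d) f = r * pairing d f := by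
  rw [pairing_eq_sum (Finsupp.support_smul : (r • d).support ⊆ d.support),
    pairing_eq_sum (subset_refl d.support), Finset.mul_sum]
  simp [mul_assoc]

theorem pairing_poly (d : ℝ →₀ ℝ) {m : ℕ} (p : Fin m → ℝ) (u : ℕ → ℝ → ℝ) :
    pairing d (fun t => ∑ j, p j * u j t) = ∑ j, p j * pairing d (u j) := by
  simp only [pairing_eq_sum (subset_refl d.support), Finset.mul_sum]
  rw [Finset.sum_comm]
  refine Finset.sum_congr rfl fun _ _ => Finset.sum_congr rfl fun _ _ => by ring

/-! ### Chebyshev determinants and polynomials with prescribed zeros -/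

/-- Convexity makes the increasing node vectors a connected set, so a determinant that never
vanishes on it keeps one sign. -/
theorem convex_strictMono_Icc (a b : ℝ) (n : ℕ) :
    Convex ℝ {t : Fin n → ℝ | StrictMono t ∧ ∀ i, t i ∈ Icc a b} := by
  intro s hs t ht x y hx hy hxy
  refine ⟨fun i j hij => ?_, fun i => convex_Icc a b (hs.2 i) (ht.2 i) hx hy hxy⟩
  have h1 := hs.1 hij
  have h2 := ht.1 hij
  simp only [Pi.add_apply, Pi.smul_apply, smul_eq_mul]
  rcases hx.eq_or_lt with rfl | hx'
  · have : y = 1 := by linarith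
    simp [this, h2]
  · have := mul_lt_mul_of_pos_left h1 hx'
    have := mul_le_mul_of_nonneg_left h2.le hy
    linarith

theorem continuousOn_chebDet {u : ℕ → ℝ → ℝ} {a b : ℝ} {n : ℕ}
    (hu : ∀ j < n, ContinuousOn (u j) (Icc a b)) :
    ContinuousOn (chebDet u n) {t : Fin n → ℝ | ∀ i, t i ∈ Icc a b} := by
  have h : ContinuousOn (fun t : Fin n → ℝ => (Matrix.of fun i j : Fin n => u i (t j)))
      {t : Fin n → ℝ | ∀ i, t i ∈ Icc a b} := by
    refine continuousOn_pi.2 fun i => continuousOn_pi.2 fun j => ?_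
    exact (hu i i.2).comp (continuous_apply j).continuousOn fun t ht => ht j
  exact (Continuous.matrix_det continuous_id).comp_continuousOn h

/-- The determinants of a Chebyshev set at increasing points have a constant sign. -/
theorem IsChebyshevSet.exists_sign {u : ℕ → ℝ → ℝ} {a b : ℝ} {n : ℕ}
    (hu : IsChebyshevSet u a b n) :
    ∃ e : ℝ, ∀ t : Fin n → ℝ, StrictMono t → (∀ i, t i ∈ Icc a b) → 0 < e * chebDet u n t := by
  by_cases hp : ∃ s : Fin n → ℝ, StrictMono s ∧ (∀ i, s i ∈ Icc a b)
  · obtain ⟨s, hs, hsI⟩ := hp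
    refine ⟨chebDet u n s, fun t ht htI => ?_⟩
    have hs0 := hu.2 s hs hsI
    have ht0 := hu.2 t ht htI
    by_contra hneg
    have hpc := (convex_strictMono_Icc a b n).isPreconnected
    have hc : ContinuousOn (chebDet u n) {t : Fin n → ℝ | StrictMono t ∧ ∀ i, t i ∈ Icc a b} :=
      (continuousOn_chebDet hu.1).mono fun t ht => ht.2
    have key : (0 : ℝ) ∈ chebDet u n '' {t : Fin n → ℝ | StrictMono t ∧ ∀ i, t i ∈ Icc a b} := by
      rcases lt_or_gt_of_ne hs0 with h | h
      · exact hpc.intermediate_value ⟨hs, hsI⟩ ⟨ht, htI⟩ hc ⟨h.le, by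
          by_contra h'; exact hneg (mul_pos_of_neg_of_neg h (not_le.1 h'))⟩
      · exact hpc.intermediate_value ⟨ht, htI⟩ ⟨hs, hsI⟩ hc ⟨by
          by_contra h'; exact hneg (mul_pos h (not_le.1 h')), h.le⟩
    obtain ⟨r, hr, hr0⟩ := key
    exact hu.2 r hr.1 hr.2 hr0
  -- Without increasing nodes in the interval the claim is vacuous, and any `e` serves.
  · exact ⟨0, fun t ht htI => (hp ⟨t, ht, htI⟩).elim⟩

/-- A generalized polynomial with prescribed simple zeros. -/
theorem exists_poly_of_zeros {u : ℕ → ℝ → ℝ} {a b : ℝ} {N : ℕ} {e : ℝ}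
    (he : ∀ t : Fin (N + 1) → ℝ, StrictMono t → (∀ i, t i ∈ Icc a b) →
      0 < e * chebDet u (N + 1) t)
    {Z : Finset ℝ} (hZ : ∀ z ∈ Z, z ∈ Icc a b) (hcard : Z.card = N) :
    ∃ p : Fin (N + 1) → ℝ, p (Fin.last N) = chebDet u N (Z.orderEmbOfFin hcard) ∧
      (∀ t ∈ Z, ∑ j, p j * u j t = 0) ∧
      ∀ t ∈ Icc a b, t ∉ Z → 0 < e * (-1) ^ (Z.filter (t < ·)).card * ∑ j, p j * u j t := by
  set z : Fin N → ℝ := ⇑(Z.orderEmbOfFin hcard) with hz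
  -- The coefficients are the cofactors of a last column placed after the columns `z`: as a function
  -- of `t` the polynomial is the determinant with nodes `z, t`, up to the sign of sorting `t` into
  -- place.
  let p : Fin (N + 1) → ℝ := fun i =>
    (-1) ^ ((i : ℕ) + N) * (Matrix.of fun α β : Fin N => u (i.succAbove α : Fin (N + 1)) (z β)).det
  have expand : ∀ (r : Fin (N + 1)) (y : Fin (N + 1) → ℝ), y ∘ r.succAbove = z →
      chebDet u (N + 1) y = (-1) ^ ((r : ℕ) + N) * ∑ j, p j * u j (y r) := by
    intro r y hy
    have hsub : ∀ i : Fin (N + 1), ((Matrix.of fun i j : Fin (N + 1) => u i (y j)).submatrix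
        i.succAbove r.succAbove) =
        (Matrix.of fun α β : Fin N => u (i.succAbove α : Fin (N + 1)) (z β)) := by
      intro i
      ext α β
      simp [← hy]
    rw [chebDet, Matrix.det_succ_column _ r, Finset.mul_sum]
    refine Finset.sum_congr rfl fun i _ => ?_
    rw [hsub]
    simp only [Matrix.of_apply, p]
    have h1 : ((-1 : ℝ)) ^ N * (-1) ^ N = 1 := by rw [← mul_pow]; simp
    rw [pow_add, pow_add, pow_add]
    linear_combination (-(-1) ^ (i : ℕ) * (-1) ^ (r : ℕ) * u i (y r) *
      (Matrix.of fun α β : Fin N => u (i.succAbove α : Fin (N + 1)) (z β)).det) * h1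
  refine ⟨p, ?_, fun t ht => ?_, fun t ht htZ => ?_⟩
  · have h1 : ((-1 : ℝ)) ^ (N + N) = 1 := by rw [pow_add, ← mul_pow]; simp
    simp only [p, Fin.val_last, h1, one_mul, chebDet, Fin.succAbove_last]
    rfl
  · obtain ⟨i, hi⟩ : ∃ i, z i = t := by
      have : t ∈ Set.range z := by rw [hz, Finset.range_orderEmbOfFin]; exact ht
      exact this
    have := expand (Fin.last N) (Fin.snoc z t) (by ext j; simp)
    simp only [Fin.snoc_last] at this
    have h0 : chebDet u (N + 1) (Fin.snoc z t) = 0 := by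
      refine Matrix.det_zero_of_column_eq (i := i.castSucc) (j := Fin.last N)
        (Fin.castSucc_lt_last i).ne fun l => ?_
      simp [hi]
    rw [h0] at this
    rcases mul_eq_zero.1 this.symm with h | h
    · exact absurd h (pow_ne_zero _ (by norm_num))
    · exact h
  · have hc : (insert t Z).card = N + 1 := by rw [Finset.card_insert_of_notMem htZ, hcard]
    set y : Fin (N + 1) → ℝ := ⇑((insert t Z).orderEmbOfFin hc) with hy
    have hymono : StrictMono y := ((insert t Z).orderEmbOfFin hc).strictMono
    have hyr : Set.range y = insert t (Z : Set ℝ) := by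
      rw [hy, Finset.range_orderEmbOfFin]; simp
    obtain ⟨r, hr⟩ : t ∈ Set.range y := by rw [hyr]; simp
    have hyz : y ∘ r.succAbove = z := by
      refine Finset.orderEmbOfFin_unique hcard (fun j => ?_)
        (hymono.comp (Fin.strictMono_succAbove r))
      have h1 : y (r.succAbove j) ∈ insert t (Z : Set ℝ) := by rw [← hyr]; exact ⟨_, rfl⟩
      rcases h1 with h1 | h1
      · exact absurd (hymono.injective (h1.trans hr.symm)) (Fin.succAbove_ne r j)
      · exact h1
    -- If `t` has position `r` among the sorted points, `N - r` zeros lie to its right; this is the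
    -- parity of the sorting permutation.
    have hcount : (Z.filter (t < ·)).card = N - r := by
      have : Z.filter (t < ·) = (Finset.Ioi r).image y := by
        ext x
        simp only [Finset.mem_filter, Finset.mem_image, Finset.mem_Ioi]
        constructor
        · rintro ⟨hx, hlt⟩
          obtain ⟨j, rfl⟩ : x ∈ Set.range y := by rw [hyr]; simp [hx]
          exact ⟨j, hymono.lt_iff_lt.1 (hr ▸ hlt), rfl⟩
        · rintro ⟨j, hj, rfl⟩
          have hlt : t < y j := hr ▸ hymono hj
          have h1 : y j ∈ insert t (Z : Set ℝ) := by rw [← hyr]; exact ⟨_, rfl⟩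
          exact ⟨h1.resolve_left hlt.ne', hlt⟩
      rw [this, Finset.card_image_of_injective _ hymono.injective, Fin.card_Ioi]
      omega
    have hyI : ∀ i, y i ∈ Icc a b := fun i => by
      have h1 : y i ∈ insert t (Z : Set ℝ) := by rw [← hyr]; exact ⟨_, rfl⟩
      rcases h1 with h1 | h1
      · exact h1 ▸ ht
      · exact hZ _ h1
    have := he y hymono hyI
    rw [expand r y hyz, hr] at this
    have hpar : ((-1 : ℝ)) ^ ((r : ℕ) + N) = (-1) ^ (N - (r : ℕ)) := by
      have hrN : (r : ℕ) ≤ N := by omega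
      have : (r : ℕ) + N = (N - r) + 2 * r := by omega
      rw [this, pow_add, pow_mul]; simp
    rw [hcount, ← hpar, mul_assoc]
    exact this

/-! ### Signed measures with vanishing moments -/

section vanishing

variable {u : ℕ → ℝ → ℝ} {a b : ℝ} {n K : ℕ} {d : ℝ →₀ ℝ} {T : Finset ℝ}

theorem pairing_poly_eq_zero (hd : ∀ j < n, pairing d (u j) = 0) {m : ℕ} (hm : m ≤ n)
    (p : Fin m → ℝ) : pairing d (fun t => ∑ j, p j * u j t) = 0 := by
  rw [pairing_poly]
  exact Finset.sum_eq_zero fun j _ => by rw [hd j (by omega), mul_zero]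

/-- At most `n` point masses with `n` vanishing moments are zero. -/
theorem eq_zero_of_card_le (hu : IsCompleteChebyshevSet u a b K) (hn : n ≤ K)
    (hT : ∀ t ∈ T, t ∈ Icc a b) (hdT : d.support ⊆ T) (hd : ∀ j < n, pairing d (u j) = 0)
    (hcard : T.card ≤ n) : d = 0 := by
  by_contra hne
  obtain ⟨t, ht⟩ := Finsupp.support_nonempty_iff.2 hne
  have htT := hdT ht
  have hpos : 0 < T.card := Finset.card_pos.2 ⟨t, htT⟩
  have hZc := Finset.card_erase_of_mem htT
  -- A polynomial vanishing on all of `T` except `t` uses only the first `T.card ≤ n` functions, and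
  -- its pairing with `d` is a single nonzero term.
  obtain ⟨e, he⟩ := (hu ((T.erase t).card + 1) (by omega)).exists_sign
  obtain ⟨p, -, h0, h1⟩ := exists_poly_of_zeros he
    (fun z hz => hT z (Finset.mem_of_mem_erase hz)) rfl
  have hsum := pairing_poly_eq_zero (n := n) hd (by omega) p
  rw [pairing_eq_sum hdT, ← Finset.add_sum_erase _ _ htT,
    Finset.sum_eq_zero (s := T.erase t) fun s hs => by rw [h0 s hs, mul_zero], add_zero] at hsum
  have := h1 t (hT t htT) (by simp)
  rcases mul_eq_zero.1 hsum with h | h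
  · exact Finsupp.mem_support_iff.1 ht h
  · rw [h, mul_zero] at this; exact lt_irrefl _ this

/-- At most `n + 1` point masses with `n` vanishing moments alternate in sign. -/
theorem exists_alternating (hu : IsCompleteChebyshevSet u a b K) (hn : n ≤ K)
    (hT : ∀ t ∈ T, t ∈ Icc a b) (hdT : d.support ⊆ T) (hd : ∀ j < n, pairing d (u j) = 0)
    (hcard : T.card ≤ n + 1) {s t : ℝ} (hs : s ∈ T) (ht : t ∈ T) (hst : s < t) :
    ∃ κ : ℝ, 0 < κ ∧ d t = -(-1) ^ (T.filter fun x => s < x ∧ x < t).card * κ * d s := by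
  -- With zeros at all other points of `T`, only the terms of `s` and `t` survive and must cancel.
  -- The zeros between `s` and `t` decide the relative sign of the polynomial there.
  set Z := (T.erase s).erase t with hZ
  have htE : t ∈ T.erase s := Finset.mem_erase.2 ⟨hst.ne', ht⟩
  have hc1 : Z.card = (T.erase s).card - 1 := Finset.card_erase_of_mem htE
  have hc2 := Finset.card_erase_of_mem hs
  have hpos : 0 < (T.erase s).card := Finset.card_pos.2 ⟨t, htE⟩
  obtain ⟨e, he⟩ := (hu (Z.card + 1) (by omega)).exists_sign
  obtain ⟨p, -, h0, h1⟩ := exists_poly_of_zeros he (Z := Z)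
    (fun z hz => hT z (Finset.mem_of_mem_erase (Finset.mem_of_mem_erase hz))) rfl
  have hsum := pairing_poly_eq_zero (n := n) hd (by omega) p
  rw [pairing_eq_sum hdT, ← Finset.add_sum_erase _ _ hs, ← Finset.add_sum_erase _ _ htE,
    Finset.sum_eq_zero (s := Z) fun s hs => by rw [h0 s hs, mul_zero], add_zero] at hsum
  have hps := h1 s (hT s hs) (by simp [hZ])
  have hpt := h1 t (hT t ht) (by simp [hZ])
  have hcount : (Z.filter (s < ·)).card = (Z.filter (t < ·)).card +
      (T.filter fun x => s < x ∧ x < t).card := by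
    rw [← Finset.card_union_of_disjoint]
    · congr 1
      ext x
      simp only [hZ, Finset.mem_filter, Finset.mem_erase, Finset.mem_union]
      constructor
      · rintro ⟨⟨h1, h2, h3⟩, h4⟩
        rcases lt_or_gt_of_ne h1 with h | h
        · exact Or.inr ⟨h3, h4, h⟩
        · exact Or.inl ⟨⟨h1, h2, h3⟩, h⟩
      · rintro (⟨⟨h1, h2, h3⟩, h4⟩ | ⟨h1, h2, h3⟩)
        · exact ⟨⟨h1, h2, h3⟩, hst.trans h4⟩
        · exact ⟨⟨h3.ne, h2.ne', h1⟩, h2⟩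
    · rw [Finset.disjoint_left]
      intro x hx hx'
      exact lt_asymm (Finset.mem_filter.1 hx).2 (Finset.mem_filter.1 hx').2.2
  rw [hcount, pow_add] at hps
  set A := ∑ j, p j * u j s
  set B := ∑ j, p j * u j t
  set σ : ℝ := (-1) ^ (T.filter fun x => s < x ∧ x < t).card with hσ
  set τ : ℝ := e * (-1) ^ (Z.filter (t < ·)).card
  have hσσ : σ * σ = 1 := by rw [hσ, ← mul_pow]; simp
  have hps' : 0 < τ * σ * A := by simpa only [τ, mul_assoc] using hps
  have hpt' : 0 < τ * B := hpt
  refine ⟨(τ * σ * A) / (τ * B), div_pos hps' hpt', ?_⟩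
  have : τ * B ≠ 0 := hpt'.ne'
  field_simp
  have hτ : τ ≠ 0 := left_ne_zero_of_mul this
  have hB : B ≠ 0 := right_ne_zero_of_mul this
  field_simp
  linear_combination hsum + d s * A * (hσσ)

/-- Between two positive masses there is a negative one. -/
theorem exists_neg_between (hu : IsCompleteChebyshevSet u a b K) (hn : n ≤ K)
    (hT : ∀ t ∈ T, t ∈ Icc a b) (hdT : d.support ⊆ T) (hd : ∀ j < n, pairing d (u j) = 0)
    (hcard : T.card ≤ n + 1) {s t : ℝ} (hst : s < t) (hs : 0 < d s) (ht : 0 < d t) :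
    ∃ x, s < x ∧ x < t ∧ d x < 0 := by
  have hsT : s ∈ T := hdT (Finsupp.mem_support_iff.2 hs.ne')
  have htT : t ∈ T := hdT (Finsupp.mem_support_iff.2 ht.ne')
  have hne : (T.filter (s < ·)).Nonempty := ⟨t, Finset.mem_filter.2 ⟨htT, hst⟩⟩
  -- Neighbours in `T` have opposite signs, so the point next to `s` is already negative and cannot
  -- be `t`.
  set x := (T.filter (s < ·)).min' hne
  have hx := Finset.mem_filter.1 ((T.filter (s < ·)).min'_mem hne)
  have hxt : x ≤ t := Finset.min'_le _ _ (Finset.mem_filter.2 ⟨htT, hst⟩)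
  obtain ⟨κ, hκ, h⟩ := exists_alternating hu hn hT hdT hd hcard hsT hx.1 hx.2
  have hem : (T.filter fun y => s < y ∧ y < x) = ∅ := by
    refine Finset.filter_eq_empty_iff.2 fun y hy hy' => ?_
    exact absurd (Finset.min'_le _ _ (Finset.mem_filter.2 ⟨hy, hy'.1⟩)) (not_le.2 hy'.2)
  have hneg : d x < 0 := by
    rw [h, hem]
    have := mul_pos hκ hs
    simpa using this
  refine ⟨x, hx.2, lt_of_le_of_ne hxt ?_, hneg⟩
  intro h
  rw [h] at hneg
  exact lt_asymm hneg ht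

/-- The sign of the first nonvanishing moment of `n + 1` point masses. -/
theorem next_moment_sign {e e' : ℝ} (hn : n + 1 ≤ K) (hu : IsCompleteChebyshevSet u a b K)
    (he : ∀ t : Fin n → ℝ, StrictMono t → (∀ i, t i ∈ Icc a b) → 0 < e * chebDet u n t)
    (he' : ∀ t : Fin (n + 1) → ℝ, StrictMono t → (∀ i, t i ∈ Icc a b) →
      0 < e' * chebDet u (n + 1) t)
    (hT : ∀ t ∈ T, t ∈ Icc a b) (hdT : d.support ⊆ T) (hd : ∀ j < n, pairing d (u j) = 0)
    (hcard : T.card ≤ n + 1) {s : ℝ} (hs : 0 < d s) (hmin : ∀ t ∈ T, s ≤ t) :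
    0 < e * e' * (-1) ^ n * pairing d (u n) := by
  have hsT : s ∈ T := hdT (Finsupp.mem_support_iff.2 hs.ne')
  have hcard' : T.card = n + 1 := by
    by_contra h
    have := eq_zero_of_card_le hu (by omega) hT hdT hd (by omega)
    rw [this] at hs
    simp at hs
  have hc : (T.erase s).card = n := by rw [Finset.card_erase_of_mem hsT]; omega
  -- The pairing with this polynomial is computed twice: by its zeros it is the term at `s`, and by
  -- the vanishing moments it is the leading coefficient times the next moment. All `n` zeros lie to
  -- the right of `s`, whence `(-1) ^ n`; the leading coefficient is a determinant of order `n`,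
  -- whence `e`.
  obtain ⟨p, hp, h0, h1⟩ := exists_poly_of_zeros he'
    (fun z hz => hT z (Finset.mem_of_mem_erase hz)) hc
  have hps := h1 s (hT s hsT) (by simp)
  have hfil : (T.erase s).filter (s < ·) = T.erase s :=
    Finset.filter_true_of_mem fun x hx =>
      lt_of_le_of_ne (hmin x (Finset.mem_of_mem_erase hx)) (Finset.ne_of_mem_erase hx).symm
  rw [hfil, hc] at hps
  have hlead := he _ ((T.erase s).orderEmbOfFin hc).strictMono fun i =>
    hT _ (Finset.mem_of_mem_erase (Finset.orderEmbOfFin_mem _ hc i))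
  rw [← hp] at hlead
  have hsum : pairing d (fun t => ∑ j, p j * u j t) = d s * ∑ j, p j * u j s := by
    rw [pairing_eq_sum hdT, ← Finset.add_sum_erase _ _ hsT,
      Finset.sum_eq_zero (s := T.erase s) fun s hs => by rw [h0 s hs, mul_zero], add_zero]
  rw [pairing_poly, Fin.sum_univ_castSucc, Finset.sum_eq_zero fun j _ => by
    rw [Fin.val_castSucc, hd j (by omega), mul_zero], zero_add, Fin.val_last] at hsum
  have h2 : 0 < (e' * (-1) ^ n * ∑ j, p j * u j s) * d s := mul_pos hps hs
  have h3 : 0 < (p (Fin.last n)) ^ 2 := by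
    have : p (Fin.last n) ≠ 0 := right_ne_zero_of_mul hlead.ne'
    positivity
  have h4 : 0 < (e * p (Fin.last n)) * ((e' * (-1) ^ n * ∑ j, p j * u j s) * d s) :=
    mul_pos hlead h2
  have h5 : (e * p (Fin.last n)) * ((e' * (-1) ^ n * ∑ j, p j * u j s) * d s) =
      (e * e' * (-1) ^ n * pairing d (u n)) * (p (Fin.last n)) ^ 2 := by
    linear_combination (-(e * p (Fin.last n) * e' * (-1) ^ n)) * hsum
  rw [h5] at h4
  exact pos_of_mul_pos_left h4 h3.le

/-- A nonzero generalized polynomial in `m` functions has fewer than `m` zeros. -/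
theorem card_lt_of_zeros {m : ℕ} (hu : IsChebyshevSet u a b m) {p : Fin m → ℝ} (hp : p ≠ 0)
    (hT : ∀ t ∈ T, t ∈ Icc a b) (h0 : ∀ t ∈ T, ∑ j, p j * u j t = 0) : T.card < m := by
  by_contra hlt
  obtain ⟨S, hST, hS⟩ := Finset.exists_subset_card_eq (not_lt.1 hlt)
  have := hu.2 _ (S.orderEmbOfFin hS).strictMono fun i =>
    hT _ (hST (Finset.orderEmbOfFin_mem _ hS i))
  refine hp (Matrix.eq_zero_of_vecMul_eq_zero this ?_)
  ext i
  simpa [Matrix.vecMul, dotProduct] using h0 _ (hST (Finset.orderEmbOfFin_mem _ hS i))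

end vanishing

/-! ### Counting points by index -/

open Classical in
/-- Twice the index of a finite set of points: interior points count for two. -/
noncomputable def dblIndex (a b : ℝ) (S : Finset ℝ) : ℕ :=
  ∑ t ∈ S, if t = a ∨ t = b then 1 else 2

theorem pointIndex_eq (a b : ℝ) (S : Finset ℝ) : pointIndex a b S = (dblIndex a b S : ℝ) / 2 := by
  rw [pointIndex, dblIndex, Nat.cast_sum, Finset.sum_div]
  refine Finset.sum_congr rfl fun t _ => ?_
  split_ifs <;> simp

theorem dblIndex_mono {a b : ℝ} {S T : Finset ℝ} (h : S ⊆ T) : dblIndex a b S ≤ dblIndex a b T :=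
  Finset.sum_le_sum_of_subset h

theorem dblIndex_erase {a b : ℝ} {S : Finset ℝ} {t : ℝ} (h : t ∈ S) :
    dblIndex a b (S.erase t) + (if t = a ∨ t = b then 1 else 2) = dblIndex a b S := by
  classical
  rw [dblIndex, dblIndex, ← Finset.sum_erase_add _ _ h]

/-- The right side counts the simple zeros needed when each interior point receives two and each
endpoint one. -/
theorem dblIndex_eq_card_add (a b : ℝ) (S : Finset ℝ) :
    dblIndex a b S = S.card + (S.filter fun t => ¬(t = a ∨ t = b)).card := by
  classical
  rw [dblIndex, Finset.card_eq_sum_ones, Finset.card_filter, ← Finset.sum_add_distrib]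
  refine Finset.sum_congr rfl fun t _ => ?_
  split_ifs <;> simp_all

/-- Parity bookkeeping: the index and the status of one endpoint determine the status of the other
and the number of points. -/
theorem dblIndex_add_ends {a b : ℝ} (hab : a < b) (S : Finset ℝ) :
    dblIndex a b S + (if a ∈ S then 1 else 0) + (if b ∈ S then 1 else 0) = 2 * S.card := by
  classical
  have h1 : (if a ∈ S then 1 else 0) = ∑ t ∈ S, if t = a then 1 else 0 := by
    rw [Finset.sum_ite_eq']
  have h2 : (if b ∈ S then 1 else 0) = ∑ t ∈ S, if t = b then 1 else 0 := by
    rw [Finset.sum_ite_eq']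
  rw [h1, h2, dblIndex, ← Finset.sum_add_distrib, ← Finset.sum_add_distrib, mul_comm,
    ← smul_eq_mul, ← Finset.sum_const]
  refine Finset.sum_congr rfl fun t _ => ?_
  by_cases ha : t = a
  · simp [ha, hab.ne]
  · by_cases hb : t = b <;> simp [ha, hb, hab.ne']

/-- The margin `2 * δ` allows shifts of points by `δ` in either direction without collisions. -/
theorem exists_separation (F : Finset ℝ) :
    ∃ δ : ℝ, 0 < δ ∧ ∀ x ∈ F, ∀ y ∈ F, x < y → x + 2 * δ < y := by
  have h : ∀ᶠ δ in nhdsWithin (0 : ℝ) (Ioi 0), ∀ x ∈ F, ∀ y ∈ F, x < y → x + 2 * δ < y := by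
    refine (Filter.eventually_all_finset F).2 fun x _ => (Filter.eventually_all_finset F).2
      fun y _ => ?_
    by_cases hxy : x < y
    · have hc : Filter.Tendsto (fun δ : ℝ => x + 2 * δ) (nhdsWithin 0 (Ioi 0)) (nhds x) := by
        have : Continuous fun δ : ℝ => x + 2 * δ := by fun_prop
        simpa using (this.tendsto 0).mono_left nhdsWithin_le_nhds
      exact (hc.eventually (gt_mem_nhds hxy)).mono fun _ h _ => h
    · exact Filter.Eventually.of_forall fun _ h => absurd h hxy
  obtain ⟨δ, h1, h2⟩ := (h.and self_mem_nhdsWithin).exists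
  exact ⟨δ, h2, h1⟩

/-! ### Index bounds for negative parts and for zeros of nonnegative polynomials -/

section index

variable {u : ℕ → ℝ → ℝ} {a b : ℝ} {n K : ℕ} {d : ℝ →₀ ℝ}

/-- If `n` moments of `d` vanish and `d` has a positive mass, then the negative part of `d` has
index at least `n / 2`. -/
theorem le_dblIndex_neg (hab : a < b) (hu : IsCompleteChebyshevSet u a b K) (hn : n ≤ K)
    (hdI : ∀ t ∈ d.support, t ∈ Icc a b) (hd : ∀ j < n, pairing d (u j) = 0)
    {y : ℝ} (hy : 0 < d y) : n ≤ dblIndex a b (d.support.filter fun t => d t < 0) := by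
  classical
  by_contra hlt
  set S := d.support.filter fun t => d t < 0 with hS
  set I := S.filter fun t => ¬(t = a ∨ t = b) with hI
  set E := S.filter fun t => (t = a ∨ t = b) with hE
  obtain ⟨δ, hδ, hsep⟩ := exists_separation (insert a (insert b d.support))
  have hSd : ∀ t ∈ S, t ∈ d.support := fun t ht => (Finset.mem_filter.1 ht).1
  have hmem : ∀ t ∈ d.support, t ∈ insert a (insert b d.support) := fun t ht => by simp [ht]
  have hId : ∀ s ∈ I, s ∈ d.support := fun s hs => hSd s (Finset.mem_filter.1 hs).1
  have hIa : ∀ s ∈ I, a + 2 * δ < s ∧ s + 2 * δ < b := fun s hs => by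
    have h1 := hdI s (hId s hs)
    have h2 := not_or.1 (Finset.mem_filter.1 hs).2
    exact ⟨hsep a (by simp) s (hmem s (hId s hs)) (lt_of_le_of_ne h1.1 (Ne.symm h2.1)),
      hsep s (hmem s (hId s hs)) b (by simp) (lt_of_le_of_ne h1.2 h2.2)⟩
  have hne : ∀ t ∈ d.support, ∀ s ∈ I, t ≠ s - δ ∧ t ≠ s + δ := fun t ht s hs => by
    constructor
    · intro h
      have := hsep t (hmem t ht) s (hmem s (hId s hs)) (by linarith)
      linarith
    · intro h
      have := hsep s (hmem s (hId s hs)) t (hmem t ht) (by linarith)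
      linarith
  have hd1 : Disjoint E (I.image (· - δ)) := by
    rw [Finset.disjoint_left]
    intro x hx hx'
    obtain ⟨s, hs, rfl⟩ := Finset.mem_image.1 hx'
    exact (hne _ (hSd _ (Finset.mem_filter.1 hx).1) s hs).1 rfl
  have hd2 : Disjoint (E ∪ I.image (· - δ)) (I.image (· + δ)) := by
    rw [Finset.disjoint_left]
    intro x hx hx'
    obtain ⟨s, hs, rfl⟩ := Finset.mem_image.1 hx'
    rcases Finset.mem_union.1 hx with hx | hx
    · exact (hne _ (hSd _ (Finset.mem_filter.1 hx).1) s hs).2 rfl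
    · obtain ⟨s', hs', h⟩ := Finset.mem_image.1 hx
      have h : s' - δ = s + δ := h
      have := hsep s (hmem s (hId s hs)) s' (hmem s' (hId s' hs')) (by linarith)
      linarith
  have inj1 : Function.Injective fun x : ℝ => x - δ := fun x y h => by simpa using h
  have inj2 : Function.Injective fun x : ℝ => x + δ := fun x y h => by simpa using h
  -- Two simple zeros `s - δ` and `s + δ` stand in for a double zero: between them the polynomial
  -- has the reversed sign, exactly at the negative mass `s`. Negative masses at endpoints are
  -- killed by a zero there. All surviving terms of the pairing then have one sign.
  set Z := E ∪ I.image (· - δ) ∪ I.image (· + δ) with hZ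
  have hcard : Z.card = dblIndex a b S := by
    rw [hZ, Finset.card_union_of_disjoint hd2, Finset.card_union_of_disjoint hd1,
      Finset.card_image_of_injective _ inj1, Finset.card_image_of_injective _ inj2,
      dblIndex_eq_card_add, ← Finset.card_filter_add_card_filter_not (s := S)
        (fun t => t = a ∨ t = b)]
  have hZI : ∀ z ∈ Z, z ∈ Icc a b := by
    intro z hz
    rcases Finset.mem_union.1 hz with hz | hz
    · rcases Finset.mem_union.1 hz with hz | hz
      · exact hdI z (hSd z (Finset.mem_filter.1 hz).1)
      · obtain ⟨s, hs, rfl⟩ := Finset.mem_image.1 hz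
        have := hIa s hs
        exact ⟨by linarith, by linarith⟩
    · obtain ⟨s, hs, rfl⟩ := Finset.mem_image.1 hz
      have := hIa s hs
      exact ⟨by linarith, by linarith⟩
  obtain ⟨e, he⟩ := (hu (Z.card + 1) (by omega)).exists_sign
  obtain ⟨p, -, h0, h1⟩ := exists_poly_of_zeros he hZI rfl
  have hsum := pairing_poly_eq_zero (n := n) hd (by omega) p
  set q : ℝ → ℝ := fun t => ∑ j, p j * u j t with hq
  -- Of the endpoint zeros only one at `b` can lie to the right of a mass point, so it contributes a
  -- common sign.
  set β : ℕ := if b ∈ S then 1 else 0 with hβ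
  have hEc : ∀ t ∈ d.support, t ∉ E → (E.filter (t < ·)).card = β := by
    intro t ht htE
    rcases (hdI t ht).2.eq_or_lt with rfl | htb
    · have : t ∉ S := fun h => htE (by simp [hE, h])
      rw [hβ, if_neg this, Finset.card_eq_zero, Finset.filter_eq_empty_iff]
      intro x hx
      exact not_lt.2 (hdI x (hSd x (Finset.mem_filter.1 hx).1)).2
    · by_cases hb : b ∈ S
      · have : E.filter (t < ·) = {b} := by
          ext x
          simp only [hE, Finset.mem_filter, Finset.mem_singleton]
          constructor
          · rintro ⟨⟨-, rfl | rfl⟩, h⟩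
            · exact absurd h (not_lt.2 (hdI t ht).1)
            · rfl
          · rintro rfl
            exact ⟨⟨hb, Or.inr rfl⟩, htb⟩
        rw [this, hβ, if_pos hb]; rfl
      · rw [hβ, if_neg hb, Finset.card_eq_zero, Finset.filter_eq_empty_iff]
        intro x hx h
        rcases (Finset.mem_filter.1 hx).2 with rfl | rfl
        · exact absurd h (not_lt.2 (hdI t ht).1)
        · exact hb (Finset.mem_filter.1 hx).1
  have hcount : ∀ t ∈ d.support, t ∉ E → ((-1 : ℝ)) ^ (Z.filter (t < ·)).card =
      (-1) ^ β * if t ∈ I then -1 else 1 := by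
    intro t ht htE
    have hA : (I.image (· - δ)).filter (t < ·) = (I.filter (t < ·)).image (· - δ) := by
      rw [Finset.filter_image]
      congr 1
      refine Finset.filter_congr fun s hs => ⟨fun h => by linarith, fun h => ?_⟩
      have := hsep t (hmem t ht) s (hmem s (hId s hs)) h
      linarith
    have hB : (I.image (· + δ)).filter (t < ·) = (I.filter (t ≤ ·)).image (· + δ) := by
      rw [Finset.filter_image]
      congr 1
      refine Finset.filter_congr fun s hs => ⟨fun h => ?_, fun h => by linarith⟩
      by_contra h'
      have := hsep s (hmem s (hId s hs)) t (hmem t ht) (not_le.1 h')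
      linarith
    have hC : (I.filter (t ≤ ·)).card = (I.filter (t < ·)).card + if t ∈ I then 1 else 0 := by
      by_cases htI : t ∈ I
      · have : I.filter (t ≤ ·) = insert t (I.filter (t < ·)) := by
          ext x
          simp only [Finset.mem_filter, Finset.mem_insert]
          constructor
          · rintro ⟨h1, h2⟩
            rcases h2.eq_or_lt with h | h
            · exact Or.inl h.symm
            · exact Or.inr ⟨h1, h⟩
          · rintro (rfl | ⟨h1, h2⟩)
            · exact ⟨htI, le_rfl⟩
            · exact ⟨h1, h2.le⟩
        rw [this, Finset.card_insert_of_notMem (by simp), if_pos htI]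
      · rw [if_neg htI, add_zero]
        congr 1
        refine Finset.filter_congr fun s hs => ⟨fun h => lt_of_le_of_ne h ?_, le_of_lt⟩
        rintro rfl; exact htI hs
    rw [hZ, Finset.filter_union, Finset.card_union_of_disjoint
      (Finset.disjoint_filter_filter hd2), Finset.filter_union, Finset.card_union_of_disjoint
      (Finset.disjoint_filter_filter hd1), hEc t ht htE, hA, hB,
      Finset.card_image_of_injective _ inj1, Finset.card_image_of_injective _ inj2, hC,
      add_assoc, pow_add]
    congr 1
    rw [← add_assoc, pow_add, pow_add, ← mul_pow]
    split_ifs <;> simp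
  have hterm : ∀ t ∈ d.support, t ∉ E → 0 < (e * (-1) ^ β) * (d t * q t) := by
    intro t ht htE
    have htZ : t ∉ Z := by
      intro hz
      rcases Finset.mem_union.1 hz with hz | hz
      · rcases Finset.mem_union.1 hz with hz | hz
        · exact htE hz
        · obtain ⟨s, hs, h⟩ := Finset.mem_image.1 hz
          exact (hne t ht s hs).1 h.symm
      · obtain ⟨s, hs, h⟩ := Finset.mem_image.1 hz
        exact (hne t ht s hs).2 h.symm
    have h2 := h1 t (hdI t ht) htZ
    rw [hcount t ht htE] at h2
    by_cases htI : t ∈ I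
    · have hdt : d t < 0 := (Finset.mem_filter.1 (Finset.mem_filter.1 htI).1).2
      rw [if_pos htI] at h2
      have := mul_pos h2 (neg_pos.2 hdt)
      simp only [hq]
      linarith
    · have hdt : 0 < d t := by
        refine lt_of_le_of_ne (not_lt.1 fun h => ?_) (Finsupp.mem_support_iff.1 ht).symm
        have htS : t ∈ S := Finset.mem_filter.2 ⟨ht, h⟩
        by_cases hte : t = a ∨ t = b
        · exact htE (Finset.mem_filter.2 ⟨htS, hte⟩)
        · exact htI (Finset.mem_filter.2 ⟨htS, hte⟩)
      rw [if_neg htI] at h2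
      have := mul_pos h2 hdt
      simp only [hq]
      linarith
  have hyd : y ∈ d.support := Finsupp.mem_support_iff.2 hy.ne'
  have hyE : y ∉ E := fun h =>
    lt_asymm hy (Finset.mem_filter.1 (Finset.mem_filter.1 h).1).2
  have hpos : 0 < (e * (-1) ^ β) * pairing d q := by
    rw [pairing_eq_sum (subset_refl _), Finset.mul_sum]
    refine Finset.sum_pos' (fun t ht => ?_) ⟨y, hyd, hterm y hyd hyE⟩
    by_cases htE : t ∈ E
    · have : q t = 0 := h0 t (by simp [hZ, htE])
      simp [this]
    · exact (hterm t ht htE).le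
  rw [hsum, mul_zero] at hpos
  exact lt_irrefl _ hpos

/-- Extreme points other than `t₀` are discarded one at a time, so the remaining ones stay
consecutive around `t₀` and no point between `t₀` and a remaining one is lost. -/
theorem exists_convex_subset {T : Finset ℝ} {t₀ : ℝ} (ht₀ : t₀ ∈ T) {m : ℕ} (hm : m + 1 ≤ T.card) :
    ∃ T' ⊆ T, t₀ ∈ T' ∧ T'.card = m + 1 ∧
      ∀ s ∈ T', ∀ x ∈ T, (t₀ < x ∧ x < s ∨ s < x ∧ x < t₀) → x ∈ T' := by
  induction hr : T.card - (m + 1) generalizing T with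
  | zero => exact ⟨T, subset_rfl, ht₀, by omega, fun s _ x hx _ => hx⟩
  | succ r ih =>
    have hne : T.Nonempty := ⟨t₀, ht₀⟩
    have step : ∀ M ∈ T, M ≠ t₀ → ((∀ x ∈ T, x ≤ M) ∨ (∀ x ∈ T, M ≤ x)) →
        ∃ T' ⊆ T, t₀ ∈ T' ∧ T'.card = m + 1 ∧
      ∀ s ∈ T', ∀ x ∈ T, (t₀ < x ∧ x < s ∨ s < x ∧ x < t₀) → x ∈ T' := by
      intro M hM hne hext
      have hc := Finset.card_erase_of_mem hM
      obtain ⟨T', h1, h2, h3, h4⟩ := ih (T := T.erase M) (Finset.mem_erase.2 ⟨hne.symm, ht₀⟩)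
        (by omega) (by omega)
      refine ⟨T', h1.trans (Finset.erase_subset _ _), h2, h3, fun s hs x hx hb => ?_⟩
      refine h4 s hs x (Finset.mem_erase.2 ⟨?_, hx⟩) hb
      rintro rfl
      have hsT := Finset.mem_of_mem_erase (h1 hs)
      rcases hext with h | h
      · have h5 := h s hsT
        have h6 := h t₀ ht₀
        rcases hb with hb | hb
        · linarith [hb.2]
        · linarith [hb.2]
      · have h5 := h s hsT
        have h6 := h t₀ ht₀
        rcases hb with hb | hb
        · linarith [hb.1]
        · linarith [hb.1]
    by_cases hM : T.max' hne = t₀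
    · refine step (T.min' hne) (T.min'_mem hne) (fun h => ?_) (Or.inr fun x hx => T.min'_le x hx)
      have : T ⊆ {t₀} := fun x hx => Finset.mem_singleton.2
        (le_antisymm (hM ▸ T.le_max' x hx) (h ▸ T.min'_le x hx))
      have := Finset.card_le_card this
      simp at this
      omega
    · exact step _ (T.max'_mem hne) hM (Or.inl fun x hx => T.le_max' x hx)

/-- More than `m` vectors in an `m`-dimensional space are dependent; the coefficients of a
dependence are the masses. -/
theorem exists_vanishing_measure (u : ℕ → ℝ → ℝ) {m : ℕ} {T : Finset ℝ} (hT : m < T.card) :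
    ∃ d : ℝ →₀ ℝ, d ≠ 0 ∧ d.support ⊆ T ∧ ∀ j < m, pairing d (u j) = 0 := by
  have hnl : ¬ LinearIndependent ℝ (fun (t : T) (j : Fin m) => u j t) := fun h => by
    have := h.fintype_card_le_finrank
    simp at this
    omega
  obtain ⟨g, hg, i, hi⟩ := Fintype.not_linearIndependent_iff.1 hnl
  let G : ℝ → ℝ := fun t => if h : t ∈ T then g ⟨t, h⟩ else 0
  have hGT : ∀ t, G t ≠ 0 → t ∈ T := fun t h => by
    by_contra h'
    exact h (dif_neg h')
  refine ⟨Finsupp.onFinset T G hGT, fun h => hi ?_, Finsupp.support_onFinset_subset,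
    fun j hj => ?_⟩
  · have := DFunLike.congr_fun h (i : ℝ)
    simpa [G] using this
  · rw [pairing_eq_sum Finsupp.support_onFinset_subset, ← Finset.sum_coe_sort]
    have := congrFun hg ⟨j, hj⟩
    simpa [G] using this

/-- Nonnegative generalized polynomials in `m` functions have few zeros. -/
theorem dblIndex_lt_of_nonneg (hab : a < b) {m : ℕ} (hu : IsCompleteChebyshevSet u a b K)
    (hm : m ≤ K) {p : Fin m → ℝ} (hp : p ≠ 0) (hpos : ∀ t ∈ Icc a b, 0 ≤ ∑ j, p j * u j t)
    {S : Finset ℝ} (hS : ∀ t ∈ S, t ∈ Icc a b) (h0 : ∀ t ∈ S, ∑ j, p j * u j t = 0) :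
    dblIndex a b S < m := by
  classical
  by_contra hlt
  obtain ⟨t₀, ht₀, hpt₀⟩ : ∃ t ∈ Icc a b, ∑ j, p j * u j t ≠ 0 := by
    by_contra! hall
    obtain ⟨W, hW, hWc⟩ := (Icc_infinite hab).exists_subset_card_eq m
    exact absurd (card_lt_of_zeros (hu m hm) hp (fun t ht => hW ht) fun t ht => hall t (hW ht))
      (by omega)
  have ht₀S : t₀ ∉ S := fun h => hpt₀ (h0 _ h)
  set I := S.filter fun t => ¬(t = a ∨ t = b) with hI
  obtain ⟨δ, hδ, hsep⟩ := exists_separation (insert t₀ (insert a (insert b S)))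
  have hmem : ∀ t ∈ S, t ∈ insert t₀ (insert a (insert b S)) := fun t ht => by simp [ht]
  have hIS : ∀ s ∈ I, s ∈ S := fun s hs => (Finset.mem_filter.1 hs).1
  have hIa : ∀ s ∈ I, a + 2 * δ < s ∧ s + 2 * δ < b := fun s hs => by
    have h1 := hS s (hIS s hs)
    have h2 := not_or.1 (Finset.mem_filter.1 hs).2
    exact ⟨hsep a (by simp) s (hmem s (hIS s hs)) (lt_of_le_of_ne h1.1 (Ne.symm h2.1)),
      hsep s (hmem s (hIS s hs)) b (by simp) (lt_of_le_of_ne h1.2 h2.2)⟩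
  -- Each interior zero gets a companion on its side away from `t₀`. With `t₀` and all zeros this
  -- makes `dblIndex a b S + 1` points, enough for a nontrivial measure with `m` vanishing moments.
  set π : ℝ → ℝ := fun s => if t₀ < s then s + δ else s - δ with hπ
  have hπr : ∀ s, t₀ < s → π s = s + δ := fun s h => if_pos h
  have hπl : ∀ s, s < t₀ → π s = s - δ := fun s h => if_neg (not_lt.2 h.le)
  have hst₀ : ∀ s ∈ S, s < t₀ ∧ s + 2 * δ < t₀ ∨ t₀ < s ∧ t₀ + 2 * δ < s := fun s hs => by
    rcases lt_trichotomy s t₀ with h | h | h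
    · exact Or.inl ⟨h, hsep _ (hmem s hs) _ (by simp) h⟩
    · exact absurd (h ▸ hs) ht₀S
    · exact Or.inr ⟨h, hsep _ (by simp) _ (hmem s hs) h⟩
  have hss : ∀ s ∈ S, ∀ s' ∈ S, s < s' → s + 2 * δ < s' := fun s hs s' hs' h =>
    hsep s (hmem s hs) s' (hmem s' hs') h
  have hπI : ∀ s ∈ I, π s ∈ Icc a b := by
    intro s hs
    have := hIa s hs
    rcases hst₀ s (hIS s hs) with h | h
    · rw [hπl s h.1]; exact ⟨by linarith, by linarith⟩
    · rw [hπr s h.1]; exact ⟨by linarith, by linarith⟩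
  have hπS : ∀ s ∈ I, π s ∉ S := by
    intro s hs h'
    rcases hst₀ s (hIS s hs) with h | h
    · rw [hπl s h.1] at h'
      have := hss _ h' s (hIS s hs) (by linarith)
      linarith
    · rw [hπr s h.1] at h'
      have := hss s (hIS s hs) _ h' (by linarith)
      linarith
  have hπinj : Set.InjOn π I := by
    intro s hs s' hs' h
    have hs1 := hIS s hs
    have hs1' := hIS s' hs'
    by_contra hne
    rcases hst₀ s hs1 with h1 | h1 <;> rcases hst₀ s' hs1' with h2 | h2
    · rw [hπl s h1.1, hπl s' h2.1] at h; exact hne (by linarith)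
    · rw [hπl s h1.1, hπr s' h2.1] at h; linarith
    · rw [hπr s h1.1, hπl s' h2.1] at h; linarith
    · rw [hπr s h1.1, hπr s' h2.1] at h; exact hne (by linarith)
  have hπt : ∀ s ∈ I, π s ≠ t₀ := by
    intro s hs
    rcases hst₀ s (hIS s hs) with h | h
    · rw [hπl s h.1]; linarith
    · rw [hπr s h.1]; intro h'; linarith
  set T₀ := insert t₀ (S ∪ I.image π) with hT₀
  have hdis : Disjoint S (I.image π) := by
    rw [Finset.disjoint_left]
    intro x hx hx'
    obtain ⟨s, hs, rfl⟩ := Finset.mem_image.1 hx'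
    exact hπS s hs hx
  have hT₀c : T₀.card = dblIndex a b S + 1 := by
    rw [hT₀, Finset.card_insert_of_notMem, Finset.card_union_of_disjoint hdis,
      Finset.card_image_of_injOn hπinj, dblIndex_eq_card_add]
    intro h
    rcases Finset.mem_union.1 h with h | h
    · exact ht₀S h
    · obtain ⟨s, hs, h⟩ := Finset.mem_image.1 h
      exact hπt s hs h
  obtain ⟨T, hTT₀, ht₀T, hTc, hconv⟩ := exists_convex_subset (T := T₀) (t₀ := t₀)
    (by simp [hT₀]) (m := m) (by omega)
  have hTI : ∀ t ∈ T, t ∈ Icc a b := by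
    intro t ht
    rcases Finset.mem_insert.1 (hTT₀ ht) with rfl | h
    · exact ht₀
    rcases Finset.mem_union.1 h with h | h
    · exact hS t h
    · obtain ⟨s, hs, rfl⟩ := Finset.mem_image.1 h
      exact hπI s hs
  obtain ⟨d₀, hd₀, hd₀T, hd₀m⟩ := exists_vanishing_measure u (T := T) (m := m) (by omega)
  have hd₀t : d₀ t₀ ≠ 0 := by
    intro h
    refine hd₀ (Finsupp.ext fun t => ?_)
    by_contra hne
    have htT : t ∈ T := hd₀T (Finsupp.mem_support_iff.2 hne)
    rcases lt_trichotomy t t₀ with h' | h' | h'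
    · obtain ⟨κ, hκ, h1⟩ := exists_alternating hu hm hTI hd₀T hd₀m hTc.le htT ht₀T h'
      rw [h] at h1
      refine (mul_ne_zero (mul_ne_zero (neg_ne_zero.2 (pow_ne_zero _ (by norm_num))) hκ.ne') hne)
        h1.symm
    · exact hne (h' ▸ h)
    · obtain ⟨κ, hκ, h1⟩ := exists_alternating hu hm hTI hd₀T hd₀m hTc.le ht₀T htT h'
      rw [h, mul_zero] at h1
      exact hne h1
  -- The factor turns the mass at `t₀` into a square, hence makes it positive.
  set d := d₀ t₀ • d₀ with hd
  have hdT : d.support ⊆ T := Finsupp.support_smul.trans hd₀T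
  have hdm : ∀ j < m, pairing d (u j) = 0 := fun j hj => by
    rw [hd, pairing_smul, hd₀m j hj, mul_zero]
  have hdt₀ : 0 < d t₀ := by
    simp only [hd, Finsupp.smul_apply, smul_eq_mul]
    exact mul_self_pos.2 hd₀t
  -- Strictly between `t₀` and a companion lie its zero and complete pairs of a zero and its
  -- companion: an odd number of points. Alternation then gives the companion the sign of `t₀`,
  -- while the masses at zeros do not matter since the polynomial vanishes there.
  have hright : ∀ s ∈ I, t₀ < s → π s ∈ T → 0 ≤ d (π s) := by
    intro s hs hts hsT
    have hlt : t₀ < π s := by rw [hπr s hts]; linarith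
    obtain ⟨κ, hκ, h1⟩ := exists_alternating hu hm hTI hdT hdm hTc.le ht₀T hsT hlt
    set B := I.filter fun x => t₀ < x ∧ x < s with hB
    have hfil : (T.filter fun x => t₀ < x ∧ x < π s) = insert s (B ∪ B.image π) := by
      ext x
      simp only [Finset.mem_filter, Finset.mem_insert, Finset.mem_union, Finset.mem_image]
      constructor
      · rintro ⟨hxT, hx1, hx2⟩
        rw [hπr s hts] at hx2
        rcases Finset.mem_insert.1 (hTT₀ hxT) with rfl | h
        · exact absurd hx1 (lt_irrefl _)
        rcases Finset.mem_union.1 h with h | h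
        · rcases lt_trichotomy x s with h' | h' | h'
          · have hxI : x ∈ I := Finset.mem_filter.2 ⟨h, not_or.2
              ⟨(lt_of_le_of_lt ht₀.1 hx1).ne', (h'.trans_le (hS s (hIS s hs)).2).ne⟩⟩
            exact Or.inr (Or.inl (Finset.mem_filter.2 ⟨hxI, hx1, h'⟩))
          · exact Or.inl h'
          · have := hss s (hIS s hs) x h h'
            linarith
        · obtain ⟨s', hs', rfl⟩ := Finset.mem_image.1 h
          rcases hst₀ s' (hIS s' hs') with h' | h'
          · rw [hπl s' h'.1] at hx1; linarith
          · rw [hπr s' h'.1] at hx2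
            exact Or.inr (Or.inr ⟨s', Finset.mem_filter.2 ⟨hs', h'.1, by linarith⟩, rfl⟩)
      · intro hx
        have : x ∈ T₀ ∧ t₀ < x ∧ x < π s := by
          rw [hπr s hts]
          rcases hx with rfl | hx | ⟨s', hs', rfl⟩
          · exact ⟨by simp [hT₀, hIS x hs], hts, by linarith⟩
          · have hx' := Finset.mem_filter.1 hx
            exact ⟨by simp [hT₀, hIS x hx'.1], hx'.2.1, by linarith [hx'.2.2]⟩
          · have hx' := Finset.mem_filter.1 hs'
            have := hss s' (hIS s' hx'.1) s (hIS s hs) hx'.2.2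
            refine ⟨?_, ?_, ?_⟩
            · rw [hT₀]
              exact Finset.mem_insert_of_mem (Finset.mem_union_right _
                (Finset.mem_image_of_mem _ hx'.1))
            · rw [hπr s' hx'.2.1]; linarith [hx'.2.1]
            · rw [hπr s' hx'.2.1]; linarith [hx'.2.2]
        exact ⟨hconv _ hsT x this.1 (Or.inl this.2), this.2⟩
    have hBI : B ⊆ I := Finset.filter_subset _ _
    have hcard : (T.filter fun x => t₀ < x ∧ x < π s).card = 2 * B.card + 1 := by
      rw [hfil, Finset.card_insert_of_notMem, Finset.card_union_of_disjoint,
        Finset.card_image_of_injOn (hπinj.mono (by exact_mod_cast hBI)), two_mul]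
      · exact Finset.disjoint_of_subset_left (hBI.trans (Finset.filter_subset _ _))
          (Finset.disjoint_of_subset_right (Finset.image_subset_image hBI) hdis)
      · intro h
        rcases Finset.mem_union.1 h with h | h
        · exact lt_irrefl _ (Finset.mem_filter.1 h).2.2
        · obtain ⟨s', hs', h⟩ := Finset.mem_image.1 h
          exact hπS s' (hBI hs') (h ▸ hIS s hs)
    rw [h1, hcard, pow_succ, pow_mul]
    have := mul_pos hκ hdt₀
    simp only [even_two, Even.neg_pow, one_pow]
    linarith
  have hleft : ∀ s ∈ I, s < t₀ → π s ∈ T → 0 ≤ d (π s) := by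
    intro s hs hts hsT
    have hlt : π s < t₀ := by rw [hπl s hts]; linarith
    obtain ⟨κ, hκ, h1⟩ := exists_alternating hu hm hTI hdT hdm hTc.le hsT ht₀T hlt
    set B := I.filter fun x => s < x ∧ x < t₀ with hB
    have hfil : (T.filter fun x => π s < x ∧ x < t₀) = insert s (B ∪ B.image π) := by
      ext x
      simp only [Finset.mem_filter, Finset.mem_insert, Finset.mem_union, Finset.mem_image]
      constructor
      · rintro ⟨hxT, hx1, hx2⟩
        rw [hπl s hts] at hx1
        rcases Finset.mem_insert.1 (hTT₀ hxT) with rfl | h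
        · exact absurd hx2 (lt_irrefl _)
        rcases Finset.mem_union.1 h with h | h
        · rcases lt_trichotomy x s with h' | h' | h'
          · have := hss x h s (hIS s hs) h'
            linarith
          · exact Or.inl h'
          · have hxI : x ∈ I := Finset.mem_filter.2 ⟨h, not_or.2
              ⟨(lt_of_le_of_lt (hS s (hIS s hs)).1 h').ne', (hx2.trans_le ht₀.2).ne⟩⟩
            exact Or.inr (Or.inl (Finset.mem_filter.2 ⟨hxI, h', hx2⟩))
        · obtain ⟨s', hs', rfl⟩ := Finset.mem_image.1 h
          rcases hst₀ s' (hIS s' hs') with h' | h'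
          · rw [hπl s' h'.1] at hx1
            exact Or.inr (Or.inr ⟨s', Finset.mem_filter.2 ⟨hs', by linarith, h'.1⟩, rfl⟩)
          · rw [hπr s' h'.1] at hx2; linarith
      · intro hx
        have : x ∈ T₀ ∧ π s < x ∧ x < t₀ := by
          rw [hπl s hts]
          rcases hx with rfl | hx | ⟨s', hs', rfl⟩
          · exact ⟨by simp [hT₀, hIS x hs], by linarith, hts⟩
          · have hx' := Finset.mem_filter.1 hx
            exact ⟨by simp [hT₀, hIS x hx'.1], by linarith [hx'.2.1], hx'.2.2⟩
          · have hx' := Finset.mem_filter.1 hs'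
            have := hss s (hIS s hs) s' (hIS s' hx'.1) hx'.2.1
            refine ⟨?_, ?_, ?_⟩
            · rw [hT₀]
              exact Finset.mem_insert_of_mem (Finset.mem_union_right _
                (Finset.mem_image_of_mem _ hx'.1))
            · rw [hπl s' hx'.2.2]; linarith [hx'.2.1]
            · rw [hπl s' hx'.2.2]; linarith [hx'.2.2]
        exact ⟨hconv _ hsT x this.1 (Or.inr this.2), this.2⟩
    have hBI : B ⊆ I := Finset.filter_subset _ _
    have hcard : (T.filter fun x => π s < x ∧ x < t₀).card = 2 * B.card + 1 := by
      rw [hfil, Finset.card_insert_of_notMem, Finset.card_union_of_disjoint,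
        Finset.card_image_of_injOn (hπinj.mono (by exact_mod_cast hBI)), two_mul]
      · exact Finset.disjoint_of_subset_left (hBI.trans (Finset.filter_subset _ _))
          (Finset.disjoint_of_subset_right (Finset.image_subset_image hBI) hdis)
      · intro h
        rcases Finset.mem_union.1 h with h | h
        · exact lt_irrefl _ (Finset.mem_filter.1 h).2.1
        · obtain ⟨s', hs', h⟩ := Finset.mem_image.1 h
          exact hπS s' (hBI hs') (h ▸ hIS s hs)
    rw [hcard, pow_succ, pow_mul] at h1
    simp only [even_two, Even.neg_pow, one_pow, one_mul, neg_neg] at h1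
    rw [h1] at hdt₀
    exact (pos_of_mul_pos_right hdt₀ hκ.le).le
  have hsum := pairing_poly_eq_zero (n := m) hdm le_rfl p
  rw [pairing_eq_sum hdT] at hsum
  have hgt : 0 < ∑ t ∈ T, d t * ∑ j, p j * u j t := by
    refine Finset.sum_pos' (fun t ht => ?_)
      ⟨t₀, ht₀T, mul_pos hdt₀ (lt_of_le_of_ne (hpos t₀ ht₀) (Ne.symm hpt₀))⟩
    rcases Finset.mem_insert.1 (hTT₀ ht) with rfl | h
    · exact mul_nonneg hdt₀.le (hpos t ht₀)
    rcases Finset.mem_union.1 h with h | h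
    · rw [h0 t h, mul_zero]
    · obtain ⟨s, hs, rfl⟩ := Finset.mem_image.1 h
      refine mul_nonneg ?_ (hpos _ (hTI _ ht))
      rcases hst₀ s (hIS s hs) with h' | h'
      · exact hleft s hs h'.1 ht
      · exact hright s hs h'.1 ht
  exact hgt.ne' hsum

end index

/-! ### The moment cone and its boundary -/

/-- The cone of the vectors of the first `m` moments of nonnegative discrete measures. -/
def momentCone (u : ℕ → ℝ → ℝ) (a b : ℝ) (m : ℕ) : Set (Fin m → ℝ) :=
  {C | ∃ σ : ℝ →₀ ℝ, (∀ t ∈ σ.support, t ∈ Icc a b) ∧ (∀ t, 0 ≤ σ t) ∧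
    ∀ j : Fin m, pairing σ (u j) = C j}

/-- A sequence is strictly positive if nonzero nonnegative generalized polynomials in the first
`K` functions have a positive value. -/
def HasPositiveMoments (u : ℕ → ℝ → ℝ) (a b : ℝ) (K : ℕ) (c : ℕ → ℝ) : Prop :=
  ∀ m ≤ K, ∀ p : Fin m → ℝ, p ≠ 0 → (∀ t ∈ Icc a b, 0 ≤ ∑ j, p j * u j t) →
    0 < ∑ j, p j * c j

/-- The convex hull of a compact set in a finite-dimensional space is compact. -/
theorem isCompact_convexHull_of_isCompact {E : Type*} [NormedAddCommGroup E] [NormedSpace ℝ E]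
    [FiniteDimensional ℝ E] {s : Set E} (hs : IsCompact s) : IsCompact (convexHull ℝ s) := by
  rcases s.eq_empty_or_nonempty with rfl | ⟨x₀, hx₀⟩
  · simp
  set N := Module.finrank ℝ E + 1
  -- By Carathéodory `N` points suffice; shorter combinations are padded with `x₀` at weight zero.
  -- The hull is thus a continuous image of a compact set.
  have himage : convexHull ℝ s = (fun q : (Fin N → ℝ) × (Fin N → E) => ∑ i, q.1 i • q.2 i) ''
      (stdSimplex ℝ (Fin N) ×ˢ Set.pi univ fun _ => s) := by
    apply Subset.antisymm
    · intro x hx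
      obtain ⟨ι, _, z, w, hz, hind, hw, hw1, rfl⟩ := eq_pos_convex_span_of_mem_convexHull hx
      have hcard : Fintype.card ι ≤ Fintype.card (Fin N) := by
        have := hind.card_le_finrank_succ
        have h2 := Submodule.finrank_le (vectorSpan ℝ (Set.range z))
        simp only [Fintype.card_fin, N]
        omega
      obtain ⟨f⟩ := Function.Embedding.nonempty_of_card_le hcard
      have hout : ∀ i, i ∉ Set.range f → Function.extend f w 0 i = 0 := fun i hi =>
        Function.extend_apply' _ _ _ fun ⟨j, hj⟩ => hi ⟨j, hj⟩
      refine ⟨(Function.extend f w 0, Function.extend f z fun _ => x₀), ⟨⟨fun i => ?_, ?_⟩,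
        fun i _ => ?_⟩, ?_⟩
      · by_cases hi : i ∈ Set.range f
        · obtain ⟨j, rfl⟩ := hi
          simp only [f.injective.extend_apply]; exact (hw j).le
        · simp only [hout i hi, le_refl]
      · rw [← hw1]
        exact (Fintype.sum_of_injective f f.injective _ _ hout fun j =>
          (f.injective.extend_apply _ _ j).symm).symm
      · by_cases hi : i ∈ Set.range f
        · obtain ⟨j, rfl⟩ := hi
          simp only [f.injective.extend_apply]
          exact hz ⟨j, rfl⟩
        · simp only [Function.extend_apply' _ _ _ fun ⟨j, hj⟩ => hi ⟨j, hj⟩]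
          exact hx₀
      · refine (Fintype.sum_of_injective f f.injective _ _ (fun i hi => ?_) fun j => ?_).symm
        · simp only [hout i hi, zero_smul]
        · simp only [f.injective.extend_apply]
    · rintro _ ⟨⟨w, z⟩, ⟨⟨hw, hw1⟩, hz⟩, rfl⟩
      exact (convex_convexHull ℝ s).sum_mem (fun i _ => hw i) hw1
        fun i _ => subset_convexHull ℝ s (hz i (mem_univ i))
  rw [himage]
  exact ((isCompact_stdSimplex ℝ (Fin N)).prod (isCompact_univ_pi fun _ => hs)).image (by fun_prop)

section cone

variable {u : ℕ → ℝ → ℝ} {a b : ℝ} {m K : ℕ} {c : ℕ → ℝ}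

theorem zero_mem_momentCone : (0 : Fin m → ℝ) ∈ momentCone u a b m :=
  ⟨0, by simp, by simp, fun j => by simp [pairing]⟩

theorem add_mem_momentCone {C D : Fin m → ℝ} (hC : C ∈ momentCone u a b m)
    (hD : D ∈ momentCone u a b m) : C + D ∈ momentCone u a b m := by
  classical
  obtain ⟨σ, h1, h2, h3⟩ := hC
  obtain ⟨τ, g1, g2, g3⟩ := hD
  refine ⟨σ + τ, fun t ht => ?_, fun t => add_nonneg (h2 t) (g2 t), fun j => ?_⟩
  · rcases Finset.mem_union.1 (Finsupp.support_add ht) with h | h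
    · exact h1 t h
    · exact g1 t h
  · rw [pairing_add, h3, g3]; rfl

theorem smul_mem_momentCone {C : Fin m → ℝ} (hC : C ∈ momentCone u a b m) {r : ℝ} (hr : 0 ≤ r) :
    r • C ∈ momentCone u a b m := by
  obtain ⟨σ, h1, h2, h3⟩ := hC
  exact ⟨r • σ, fun t ht => h1 t (Finsupp.support_smul ht), fun t => mul_nonneg hr (h2 t),
    fun j => by rw [pairing_smul, h3]; rfl⟩

theorem mem_momentCone_of_mem_Icc {t : ℝ} (ht : t ∈ Icc a b) :
    (fun j : Fin m => u j t) ∈ momentCone u a b m := by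
  classical
  refine ⟨Finsupp.single t 1, fun s hs => ?_, fun s => ?_, fun j => ?_⟩
  · have := Finsupp.support_single_subset hs
    rw [Finset.mem_singleton.1 this]; exact ht
  · rw [Finsupp.single_apply]; split_ifs <;> norm_num
  · rw [pairing_single, one_mul]

theorem convex_momentCone : Convex ℝ (momentCone u a b m) := fun _ hx _ hy _ _ hr hs _ =>
  add_mem_momentCone (smul_mem_momentCone hx hr) (smul_mem_momentCone hy hs)

theorem IsChebyshevSet.exists_sign_first (hu : IsChebyshevSet u a b 1) :
    ∃ e : ℝ, ∀ t ∈ Icc a b, 0 < e * u 0 t := by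
  obtain ⟨e, he⟩ := hu.exists_sign
  refine ⟨e, fun t ht => ?_⟩
  have := he (fun _ => t) (Subsingleton.strictMono _) fun _ => ht
  simpa [chebDet] using this

/-- Division by `e * u 0` brings the moment curve to height one. The cone consists of the
nonnegative multiples of a compact convex hull, with the height as multiplier, so along a convergent
sequence the heights converge and the hull points subconverge. -/
theorem isClosed_momentCone (hab : a < b) (hu : IsCompleteChebyshevSet u a b K) (hm : 0 < m)
    (hmK : m ≤ K) : IsClosed (momentCone u a b m) := by
  obtain ⟨e, he⟩ := (hu 1 (by omega)).exists_sign_first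
  set γ : ℝ → Fin m → ℝ := fun t => (e * u 0 t)⁻¹ • fun j : Fin m => u j t with hγ
  set H := convexHull ℝ (γ '' Icc a b) with hH
  have hγc : ContinuousOn γ (Icc a b) := by
    refine ContinuousOn.smul (ContinuousOn.inv₀ (continuousOn_const.mul
      ((hu 1 (by omega)).1 0 (by omega))) fun t ht => (he t ht).ne') ?_
    exact continuousOn_pi.2 fun j => (hu m hmK).1 j j.2
  have hHc : IsCompact H :=
    isCompact_convexHull_of_isCompact (isCompact_Icc.image_of_continuousOn hγc)
  have hHne : H.Nonempty := ⟨γ a, subset_convexHull _ _ ⟨a, ⟨le_rfl, hab.le⟩, rfl⟩⟩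
  have hHM : H ⊆ momentCone u a b m := by
    refine convexHull_min ?_ convex_momentCone
    rintro _ ⟨t, ht, rfl⟩
    exact smul_mem_momentCone (mem_momentCone_of_mem_Icc ht) (inv_nonneg.2 (he t ht).le)
  have hMH : ∀ C ∈ momentCone u a b m, 0 ≤ e * C ⟨0, hm⟩ ∧ ∃ h ∈ H, C = (e * C ⟨0, hm⟩) • h := by
    rintro C ⟨σ, h1, h2, h3⟩
    have hwt : ∀ t ∈ σ.support, 0 < σ t * (e * u 0 t) := fun t ht =>
      mul_pos (lt_of_le_of_ne (h2 t) (Finsupp.mem_support_iff.1 ht).symm) (he t (h1 t ht))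
    have hC0 : e * C ⟨0, hm⟩ = ∑ t ∈ σ.support, σ t * (e * u 0 t) := by
      rw [← h3, pairing_eq_sum (subset_refl _), Finset.mul_sum]
      exact Finset.sum_congr rfl fun t _ => by ring
    refine ⟨by rw [hC0]; exact Finset.sum_nonneg fun t ht => (hwt t ht).le, ?_⟩
    rcases σ.support.eq_empty_or_nonempty with hemp | hne
    · obtain ⟨h, hh⟩ := hHne
      refine ⟨h, hh, ?_⟩
      rw [hC0, hemp, Finset.sum_empty, zero_smul]
      ext j
      rw [← h3, pairing_eq_sum (subset_refl _), hemp]; rfl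
    · have hpos : 0 < ∑ t ∈ σ.support, σ t * (e * u 0 t) := Finset.sum_pos hwt hne
      refine ⟨σ.support.centerMass (fun t => σ t * (e * u 0 t)) γ,
        Finset.centerMass_mem_convexHull _ (fun t ht => (hwt t ht).le) hpos
          fun t ht => ⟨t, h1 t ht, rfl⟩, ?_⟩
      rw [hC0, Finset.centerMass, smul_smul, mul_inv_cancel₀ hpos.ne', one_smul]
      ext j
      rw [← h3, pairing_eq_sum (subset_refl _), Finset.sum_apply]
      refine Finset.sum_congr rfl fun t ht => ?_
      have := (he t (h1 t ht)).ne'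
      simp only [hγ, Pi.smul_apply, smul_eq_mul]
      rw [mul_assoc (σ t), mul_inv_cancel_left₀ this]
  refine IsSeqClosed.isClosed fun C D hC hCD => ?_
  choose h0 h hhH hCh using fun n => hMH _ (hC n)
  obtain ⟨g, hg, φ, hφ, hlim⟩ := hHc.tendsto_subseq hhH
  have hCφ := hCD.comp hφ.tendsto_atTop
  have hC0 : Filter.Tendsto (fun n => e * C n ⟨0, hm⟩) Filter.atTop
      (nhds (e * D ⟨0, hm⟩)) := (((continuous_apply _).tendsto D).comp hCD).const_mul e
  have hD0 : 0 ≤ e * D ⟨0, hm⟩ := ge_of_tendsto' hC0 h0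
  have hD : D = (e * D ⟨0, hm⟩) • g := by
    refine tendsto_nhds_unique hCφ ?_
    refine ((hC0.comp hφ.tendsto_atTop).smul hlim).congr fun n => ?_
    exact (hCh (φ n)).symm
  rw [hD]
  exact smul_mem_momentCone (hHM hg) hD0

/-- Separation of a vector from the moment cone by a nonnegative generalized polynomial. -/
theorem exists_poly_of_notMem_momentCone (hab : a < b) (hu : IsCompleteChebyshevSet u a b K)
    (hm : 0 < m) (hmK : m ≤ K) {C : Fin m → ℝ} (hC : C ∉ momentCone u a b m) :
    ∃ p : Fin m → ℝ, (∀ t ∈ Icc a b, 0 ≤ ∑ j, p j * u j t) ∧ ∑ j, p j * C j < 0 := by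
  obtain ⟨f, r, hf, hr⟩ := geometric_hahn_banach_point_closed convex_momentCone
    (isClosed_momentCone hab hu hm hmK) hC
  have hfs : ∀ x : Fin m → ℝ, f x = ∑ j, f (Pi.single j 1) * x j := fun x => by
    have := LinearMap.pi_apply_eq_sum_univ f.toLinearMap x
    simp only [ContinuousLinearMap.coe_coe, smul_eq_mul] at this
    rw [this]
    refine Finset.sum_congr rfl fun j _ => ?_
    rw [mul_comm]
    congr 2
    ext i
    simp [Pi.single_apply, eq_comm]
  have hr0 : r < 0 := by simpa using hr 0 zero_mem_momentCone
  refine ⟨fun j => f (Pi.single j 1), fun t ht => ?_, ?_⟩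
  · rw [← hfs fun j => u j t]
    by_contra hneg
    have hneg := not_le.1 hneg
    have := hr _ (smul_mem_momentCone (mem_momentCone_of_mem_Icc (u := u) (m := m) ht)
      (r := r / f fun j : Fin m => u j t) (div_nonneg_of_nonpos hr0.le hneg.le))
    rw [map_smul, smul_eq_mul, div_mul_cancel₀ _ hneg.ne] at this
    exact lt_irrefl _ this
  · rw [← hfs]; exact hf.trans hr0

theorem HasPositiveMoments.mem_momentCone (hc : HasPositiveMoments u a b K c) (hab : a < b)
    (hu : IsCompleteChebyshevSet u a b K) (hm : 0 < m) (hmK : m ≤ K) :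
    (fun j : Fin m => c j) ∈ momentCone u a b m := by
  by_contra h
  obtain ⟨p, hp, hneg⟩ := exists_poly_of_notMem_momentCone hab hu hm hmK h
  have hp0 : p ≠ 0 := by rintro rfl; simp at hneg
  exact lt_asymm hneg (hc m hmK p hp0 hp)

/-- A separating polynomial would be nonnegative with a negative integral; hence discrete measures
already give all moment vectors. -/
theorem measure_mem_momentCone (hab : a < b) (hu : IsCompleteChebyshevSet u a b K)
    (hm : 0 < m) (hmK : m ≤ K) (ρ : Measure ℝ) [IsFiniteMeasure ρ] :
    (fun j : Fin m => ∫ t in Icc a b, u j t ∂ρ) ∈ momentCone u a b m := by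
  by_contra h
  obtain ⟨p, hp, hneg⟩ := exists_poly_of_notMem_momentCone hab hu hm hmK h
  have hint : ∀ j : Fin m, Integrable (fun t => p j * u j t) (ρ.restrict (Icc a b)) := fun j =>
    (((hu m hmK).1 j j.2).integrableOn_compact isCompact_Icc).const_mul _
  have : ∑ j, p j * ∫ t in Icc a b, u j t ∂ρ = ∫ t in Icc a b, ∑ j, p j * u j t ∂ρ := by
    rw [integral_finsetSum _ fun j _ => hint j]
    exact Finset.sum_congr rfl fun j _ => (integral_const_mul _ _).symm
  rw [this] at hneg
  exact absurd (setIntegral_nonneg measurableSet_Icc hp) (not_le.2 hneg)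

/-- Moving from an interior point of the moment cone in a direction `-v` outside the cone one
reaches a boundary point, all of whose representations have small index. -/
theorem exists_boundary_point (hab : a < b) (hu : IsCompleteChebyshevSet u a b K)
    (hc : HasPositiveMoments u a b K c) (hm : 0 < m) (hmK : m ≤ K) {v : Fin m → ℝ}
    (hv : -v ∉ momentCone u a b m) :
    ∃ ε : ℝ, 0 < ε ∧ (fun j : Fin m => c j) - ε • v ∈ momentCone u a b m ∧
      (∀ ε', (fun j : Fin m => c j) - ε' • v ∈ momentCone u a b m → ε' ≤ ε) ∧
      ∀ σ : ℝ →₀ ℝ, (∀ t ∈ σ.support, t ∈ Icc a b) → (∀ t, 0 ≤ σ t) →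
        (∀ j : Fin m, pairing σ (u j) = c j - ε * v j) → dblIndex a b σ.support < m := by
  set C : Fin m → ℝ := fun j : Fin m => c j with hC
  have hcl := isClosed_momentCone hab hu hm hmK
  set A : Set ℝ := {ε | C - ε • v ∈ momentCone u a b m} with hA
  have hAcl : IsClosed A := hcl.preimage (by fun_prop)
  have hA0 : (0 : ℝ) ∈ A := by
    simp only [hA, mem_ofPred_eq, zero_smul, sub_zero]
    exact hc.mem_momentCone hab hu hm hmK
  -- If the ray stayed in the cone, its rescaled points would converge to `-v`, which closedness
  -- excludes.
  have hbdd : BddAbove A := by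
    by_contra hnb
    have hex : ∀ n : ℕ, ∃ ε ∈ A, (n : ℝ) + 1 < ε := fun n => by
      simpa using not_bddAbove_iff.1 hnb (n + 1)
    choose s hsA hs using hex
    have hspos : ∀ n, 0 < s n := fun n => lt_trans (by positivity) (hs n)
    have hsinf : Filter.Tendsto (fun n => (s n)⁻¹) Filter.atTop (nhds 0) := by
      refine Filter.Tendsto.inv_tendsto_atTop ?_
      refine Filter.tendsto_atTop_mono (fun n => ?_) tendsto_natCast_atTop_atTop
      linarith [hs n]
    have hlim : Filter.Tendsto (fun n => (s n)⁻¹ • (C - s n • v)) Filter.atTop (nhds (-v)) := by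
      have h1 : Filter.Tendsto (fun n => (s n)⁻¹ • C - v) Filter.atTop
          (nhds ((0 : ℝ) • C - v)) := (hsinf.smul_const C).sub_const v
      rw [zero_smul, zero_sub] at h1
      refine h1.congr fun n => ?_
      rw [smul_sub, smul_smul, inv_mul_cancel₀ (hspos n).ne', one_smul]
    exact hv (hcl.mem_of_tendsto hlim (Filter.Eventually.of_forall fun n =>
      smul_mem_momentCone (hsA n) (inv_nonneg.2 (hspos n).le)))
  set ε := sSup A with hε
  have hεA : ε ∈ A := hAcl.csSup_mem ⟨0, hA0⟩ hbdd
  have hmax : ∀ ε', C - ε' • v ∈ momentCone u a b m → ε' ≤ ε := fun ε' h => le_csSup hbdd h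
  have hnot : ∀ n : ℕ, C - (ε + 1 / ((n : ℝ) + 1)) • v ∉ momentCone u a b m := fun n h => by
    have := hmax _ h
    have : (0 : ℝ) < 1 / ((n : ℝ) + 1) := by positivity
    linarith
  -- Polynomials separating points just beyond the exit point are normalized; a limit `q` supports
  -- the cone at the exit point.
  choose p hp hpneg using fun n => exists_poly_of_notMem_momentCone hab hu hm hmK (hnot n)
  have hp0 : ∀ n, 0 < ‖p n‖ := fun n => norm_pos_iff.2 fun h => by
    have := hpneg n
    rw [h] at this
    simp at this
  obtain ⟨q, hq, φ, hφ, hlim⟩ := (isCompact_sphere (0 : Fin m → ℝ) 1).tendsto_subseq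
    (x := fun n => ‖p n‖⁻¹ • p n) fun n => by
      rw [mem_sphere_zero_iff_norm, norm_smul, norm_inv, norm_norm, inv_mul_cancel₀ (hp0 n).ne']
  have hq0 : q ≠ 0 := by
    rintro rfl
    simp at hq
  have hqpos : ∀ t ∈ Icc a b, 0 ≤ ∑ j, q j * u j t := by
    intro t ht
    have hcont : Continuous fun x : Fin m → ℝ => ∑ j, x j * u j t := by fun_prop
    refine ge_of_tendsto' ((hcont.tendsto q).comp hlim) fun n => ?_
    simp only [Function.comp_apply, Pi.smul_apply, smul_eq_mul, mul_assoc, ← Finset.mul_sum]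
    exact mul_nonneg (inv_nonneg.2 (hp0 _).le) (hp _ t ht)
  have hqC : ∑ j, q j * (c j - ε * v j) ≤ 0 := by
    have hcont : Continuous fun x : (Fin m → ℝ) × ℝ =>
      ∑ j, x.1 j * (c j - (ε + x.2) * v j) := by fun_prop
    have h0 : Filter.Tendsto (fun n => 1 / (((φ n : ℕ) : ℝ) + 1)) Filter.atTop (nhds 0) :=
      tendsto_one_div_add_atTop_nhds_zero_nat.comp hφ.tendsto_atTop
    have := (hcont.tendsto (q, 0)).comp (hlim.prodMk_nhds h0)
    simp only [add_zero] at this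
    refine le_of_tendsto' this fun n => ?_
    simp only [Function.comp_apply, Pi.smul_apply, smul_eq_mul, mul_assoc, ← Finset.mul_sum]
    refine mul_nonpos_of_nonneg_of_nonpos (inv_nonneg.2 (hp0 _).le) ?_
    have := (hpneg (φ n)).le
    simpa [hC] using this
  -- For `ε = 0` the polynomial `q` would contradict the strict positivity of `c`.
  have hε0 : 0 < ε := by
    refine lt_of_le_of_ne (hmax 0 (by simpa [hA] using hA0)) fun h => ?_
    rw [← h] at hqC
    simp only [zero_mul, sub_zero] at hqC
    exact absurd (hc m hmK q hq0 hqpos) (not_lt.2 hqC)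
  refine ⟨ε, hε0, hεA, hmax, fun σ hσI hσ0 hσ => ?_⟩
  -- A nonnegative `q` with nonpositive integral vanishes at every root.
  have hpair : pairing σ (fun t => ∑ j, q j * u j t) ≤ 0 := by
    rw [pairing_poly]
    simpa only [hσ] using hqC
  rw [pairing_eq_sum (subset_refl _)] at hpair
  have hterm : ∀ t ∈ σ.support, 0 ≤ σ t * ∑ j, q j * u j t := fun t ht =>
    mul_nonneg (hσ0 t) (hqpos t (hσI t ht))
  have hz := (Finset.sum_eq_zero_iff_of_nonneg hterm).1
    (le_antisymm hpair (Finset.sum_nonneg hterm))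
  exact dblIndex_lt_of_nonneg hab hu hmK hq0 hqpos hσI fun t ht =>
    (mul_eq_zero.1 (hz t ht)).resolve_left (Finsupp.mem_support_iff.1 ht)

/-- The moments of an almost everywhere positive weight function are strictly positive. -/
theorem hasPositiveMoments_weightMoment (hab : a < b) (hu : IsCompleteChebyshevSet u a b K)
    {w : ℝ → ℝ} (hw : IntervalIntegrable w volume a b)
    (hwpos : ∀ᵐ t : ℝ, t ∈ Ioo a b → 0 < w t) :
    HasPositiveMoments u a b K (weightMoment u a b w) := by
  intro m hmK p hp hpos
  have hcont : ∀ j : Fin m, ContinuousOn (u j) (uIcc a b) := fun j => by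
    rw [uIcc_of_le hab.le]; exact (hu m hmK).1 j j.2
  have hint : ∀ j : Fin m, IntervalIntegrable (fun t => u j t * w t) volume a b := fun j =>
    hw.continuousOn_mul (hcont j)
  have hsum : ∑ j, p j * weightMoment u a b w j = ∫ t in a..b, (∑ j, p j * u j t) * w t := by
    simp only [weightMoment, ← intervalIntegral.integral_const_mul]
    rw [← intervalIntegral.integral_finsetSum fun j _ => (hint j).const_mul _]
    refine intervalIntegral.integral_congr fun t _ => ?_
    simp only [Finset.sum_mul, mul_assoc]
  -- A nonzero polynomial has finitely many zeros, so its product with `w` is positive almost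
  -- everywhere.
  have hfin : {t | t ∈ Icc a b ∧ ∑ j, p j * u j t = 0}.Finite := by
    by_contra hinf
    obtain ⟨W, hW, hWc⟩ := Set.Infinite.exists_subset_card_eq hinf m
    exact absurd (card_lt_of_zeros (hu m hmK) hp (fun t ht => (hW ht).1) fun t ht => (hW ht).2)
      (by omega)
  have hae : ∀ᵐ t : ℝ, t ∈ Ioo a b → 0 < (∑ j, p j * u j t) * w t := by
    have h1 : ∀ᵐ t : ℝ, t ∉ {t | t ∈ Icc a b ∧ ∑ j, p j * u j t = 0} :=
      measure_eq_zero_iff_ae_notMem.1 (hfin.measure_zero volume)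
    filter_upwards [h1, hwpos] with t ht1 ht2 ht
    have htI := Ioo_subset_Icc_self ht
    exact mul_pos (lt_of_le_of_ne (hpos t htI) fun h => ht1 ⟨htI, h.symm⟩) (ht2 ht)
  have hI : IntervalIntegrable (fun t => (∑ j, p j * u j t) * w t) volume a b :=
    hw.continuousOn_mul (continuousOn_finsetSum _ fun j _ => continuousOn_const.mul (hcont j))
  rw [hsum, intervalIntegral.integral_pos_iff_support_of_nonneg_ae' ?_ hI]
  · refine ⟨hab, ((Measure.measure_Ioo_pos volume).2 hab).trans_le (measure_mono_ae ?_)⟩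
    filter_upwards [hae] with t ht htI
    exact ⟨Function.mem_support.2 (ht htI).ne', Ioo_subset_Ioc_self htI⟩
  · rw [Filter.EventuallyLE, uIoc_of_le hab.le]
    refine ae_restrict_of_ae_eq_of_ae_restrict Ioo_ae_eq_Ioc ?_
    rw [ae_restrict_iff' measurableSet_Ioo]
    filter_upwards [hae] with t ht htI using (ht htI).le

end cone

/-! ### Existence, uniqueness and extremality of representations -/

section representations

variable {u : ℕ → ℝ → ℝ} {a b : ℝ} {n K : ℕ} {c : ℕ → ℝ} {σ τ : ℝ →₀ ℝ} {ξ : ℝ}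

theorem eq_zero_of_pairing_eq_zero (hu : IsChebyshevSet u a b 1)
    (hI : ∀ t ∈ σ.support, t ∈ Icc a b) (h0 : ∀ t, 0 ≤ σ t) (h : pairing σ (u 0) = 0) :
    σ = 0 := by
  obtain ⟨e, he⟩ := hu.exists_sign_first
  have hs : ∑ t ∈ σ.support, σ t * (e * u 0 t) = 0 := by
    have : ∑ t ∈ σ.support, σ t * (e * u 0 t) = e * pairing σ (u 0) := by
      rw [pairing_eq_sum (subset_refl _), Finset.mul_sum]
      exact Finset.sum_congr rfl fun t _ => by ring
    rw [this, h, mul_zero]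
  have hz := (Finset.sum_eq_zero_iff_of_nonneg fun t ht =>
    mul_nonneg (h0 t) (he t (hI t ht)).le).1 hs
  refine Finsupp.support_eq_empty.1 (Finset.eq_empty_of_forall_notMem fun t ht => ?_)
  rcases mul_eq_zero.1 (hz t ht) with h | h
  · exact Finsupp.mem_support_iff.1 ht h
  · exact (he t (hI t ht)).ne' h

theorem IsRepresentation.nonneg (hσ : IsRepresentation u a b n c σ) (t : ℝ) : 0 ≤ σ t := by
  by_cases h : t ∈ σ.support
  · exact (hσ.pos t h).le
  · rw [Finsupp.notMem_support_iff.1 h]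

theorem IsRepresentation.of_nonneg (hI : ∀ t ∈ σ.support, t ∈ Icc a b) (h0 : ∀ t, 0 ≤ σ t)
    (h : ∀ j < n, pairing σ (u j) = c j) : IsRepresentation u a b n c σ :=
  ⟨hI, fun t ht => lt_of_le_of_ne (h0 t) (Finsupp.mem_support_iff.1 ht).symm, h⟩

theorem IsRepresentation.pairing_sub_eq_zero (hσ : IsRepresentation u a b n c σ)
    (hτ : IsRepresentation u a b n c τ) : ∀ j < n, pairing (σ - τ) (u j) = 0 := fun j hj => by
  rw [pairing_sub]
  exact sub_eq_zero.2 ((hσ.moment j hj).trans (hτ.moment j hj).symm)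

theorem IsRepresentation.union_subset (hσ : IsRepresentation u a b n c σ)
    (hτ : IsRepresentation u a b n c τ) : ∀ t ∈ σ.support ∪ τ.support, t ∈ Icc a b := fun t ht => by
  rcases Finset.mem_union.1 ht with h | h
  · exact hσ.mem_Icc t h
  · exact hτ.mem_Icc t h

theorem support_sub_subset (σ τ : ℝ →₀ ℝ) : (σ - τ).support ⊆ σ.support ∪ τ.support := by
  classical exact Finsupp.support_sub

/-- Two representations whose roots other than `ξ` have index less than `n / 2` agree. -/
theorem IsRepresentation.eq_of_dblIndex_erase_lt (hab : a < b)
    (hu : IsCompleteChebyshevSet u a b K) (hn : n ≤ K) (hσ : IsRepresentation u a b n c σ)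
    (hτ : IsRepresentation u a b n c τ) (h1 : dblIndex a b (σ.support.erase ξ) < n)
    (h2 : dblIndex a b (τ.support.erase ξ) < n) : σ = τ := by
  -- With the larger mass at `ξ` belonging to `σ`, the negative part of `σ - τ` sits on roots of `τ`
  -- other than `ξ`. Its index is too small for `σ - τ` to have a positive mass.
  wlog hle : τ ξ ≤ σ ξ generalizing σ τ with H
  · exact (H hτ hσ h2 h1 (not_le.1 hle).le).symm
  have hall : ∀ y, (σ - τ) y ≤ 0 := by
    intro y
    by_contra hy
    have := le_dblIndex_neg hab hu hn
      (fun t ht => hσ.union_subset hτ t (support_sub_subset σ τ ht))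
      (hσ.pairing_sub_eq_zero hτ) (not_le.1 hy)
    refine absurd (this.trans (dblIndex_mono (T := τ.support.erase ξ) fun t ht => ?_))
      (not_le.2 h2)
    have ht := (Finset.mem_filter.1 ht).2
    simp only [Finsupp.coe_sub, Pi.sub_apply] at ht
    refine Finset.mem_erase.2 ⟨?_, Finsupp.mem_support_iff.2 ?_⟩
    · rintro rfl
      linarith
    · have := hσ.nonneg t
      intro h
      linarith
  have := eq_zero_of_pairing_eq_zero (hu 1 (by omega)) (σ := τ - σ)
    (fun t ht => hτ.union_subset hσ t (support_sub_subset τ σ ht))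
    (fun t => by have := hall t; simp only [Finsupp.coe_sub, Pi.sub_apply] at this ⊢; linarith)
    (hτ.pairing_sub_eq_zero hσ 0 (by omega))
  exact (sub_eq_zero.1 this).symm

theorem IsRepresentation.eq_of_card_le (hu : IsCompleteChebyshevSet u a b K) (hn : n ≤ K)
    (hσ : IsRepresentation u a b n c σ) (hτ : IsRepresentation u a b n c τ)
    (h : (σ.support ∪ τ.support).card ≤ n) : σ = τ :=
  sub_eq_zero.1 (eq_zero_of_card_le hu hn (hσ.union_subset hτ) (support_sub_subset σ τ)
    (hσ.pairing_sub_eq_zero hτ) h)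

/-- The largest multiple of the moment vector of the unit mass at `ξ` that can be removed within the
cone is removed, and added back as a mass at `ξ`. The remainder is a boundary point, so its roots
have small index. -/
theorem exists_representation_at (hab : a < b) (hu : IsCompleteChebyshevSet u a b K)
    (hc : HasPositiveMoments u a b K c) (hn0 : 0 < n) (hn : n ≤ K) (hξ : ξ ∈ Icc a b) :
    ∃ σ, IsRepresentation u a b n c σ ∧ ξ ∈ σ.support ∧
      dblIndex a b (σ.support.erase ξ) < n := by
  classical
  have hv : -(fun j : Fin n => u j ξ) ∉ momentCone u a b n := by
    rintro ⟨σ, h1, h2, h3⟩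
    have h30 := h3 ⟨0, hn0⟩
    obtain ⟨e, he⟩ := (hu 1 (by omega)).exists_sign_first
    have : 0 ≤ e * pairing σ (u 0) := by
      rw [pairing_eq_sum (subset_refl _), Finset.mul_sum]
      refine Finset.sum_nonneg fun t ht => ?_
      have := mul_nonneg (h2 t) (he t (h1 t ht)).le
      linarith
    have h4 := he ξ hξ
    simp only [Pi.neg_apply] at h30
    rw [h30] at this
    linarith
  obtain ⟨ε, hε, ⟨σ, h1, h2, h3⟩, -, hidx⟩ := exists_boundary_point hab hu hc hn0 hn hv
  have h2' : ∀ t, 0 ≤ (σ + Finsupp.single ξ ε) t := fun t => by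
    rw [Finsupp.add_apply, Finsupp.single_apply]
    have := h2 t
    split_ifs <;> linarith
  have hsub : (σ + Finsupp.single ξ ε).support ⊆ insert ξ σ.support := by
    intro t ht
    rcases Finset.mem_union.1 (Finsupp.support_add ht) with h | h
    · exact Finset.mem_insert_of_mem h
    · exact Finset.mem_insert.2 (Or.inl (Finset.mem_singleton.1 (Finsupp.support_single_subset h)))
  refine ⟨σ + Finsupp.single ξ ε, .of_nonneg (fun t ht => ?_) h2' fun j hj => ?_, ?_, ?_⟩
  · rcases Finset.mem_insert.1 (hsub ht) with rfl | h
    · exact hξ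
    · exact h1 t h
  · rw [pairing_add, pairing_single, h3 ⟨j, hj⟩]
    simp
  · rw [Finsupp.mem_support_iff, Finsupp.add_apply, Finsupp.single_eq_same]
    have := h2 ξ
    linarith
  · refine lt_of_le_of_lt (dblIndex_mono fun t ht => ?_) (hidx σ h1 h2 h3)
    have := Finset.mem_erase.1 ht
    exact (Finset.mem_insert.1 (hsub this.2)).resolve_left this.1

/-- Compare `σ` with a representation `τ` having a root `η` outside `σ`: the difference `τ - σ` is
positive at `η`, and its negative part is carried by the roots of `σ`. -/
theorem IsRepresentation.le_dblIndex (hab : a < b) (hu : IsCompleteChebyshevSet u a b K)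
    (hc : HasPositiveMoments u a b K c) (hn : n ≤ K)
    (hσ : IsRepresentation u a b n c σ) : n ≤ dblIndex a b σ.support := by
  rcases Nat.eq_zero_or_pos n with rfl | hn0
  · exact Nat.zero_le _
  obtain ⟨η, hη, hησ⟩ := (Icc_infinite hab).exists_notMem_finset σ.support
  obtain ⟨τ, hτ, hητ, -⟩ := exists_representation_at hab hu hc hn0 hn hη
  have hpos : 0 < (τ - σ) η := by
    rw [Finsupp.sub_apply, Finsupp.notMem_support_iff.1 hησ, sub_zero]
    exact hτ.pos η hητ
  refine (le_dblIndex_neg hab hu hn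
    (fun t ht => hτ.union_subset hσ t (support_sub_subset τ σ ht))
    (hτ.pairing_sub_eq_zero hσ) hpos).trans (dblIndex_mono fun t ht => ?_)
  have ht := (Finset.mem_filter.1 ht).2
  rw [Finsupp.sub_apply] at ht
  have := hτ.nonneg t
  refine Finsupp.mem_support_iff.2 fun h => ?_
  linarith

theorem isPrincipal_iff : IsPrincipal u a b n c σ ↔
    IsRepresentation u a b n c σ ∧ dblIndex a b σ.support = n := by
  rw [IsPrincipal, pointIndex_eq]
  refine and_congr_right fun _ => ⟨fun h => ?_, fun h => by rw [h]⟩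
  have : (dblIndex a b σ.support : ℝ) = n := by linarith
  exact_mod_cast this

theorem isCanonical_iff : IsCanonical u a b n c σ ↔
    IsRepresentation u a b n c σ ∧ dblIndex a b σ.support = n + 1 := by
  rw [IsCanonical, pointIndex_eq]
  refine and_congr_right fun _ => ⟨fun h => ?_, fun h => by rw [h]; push_cast; ring⟩
  have : (dblIndex a b σ.support : ℝ) = (n + 1 : ℕ) := by push_cast; linarith
  exact_mod_cast this

theorem IsCanonicalAt.isRepresentation (h : IsCanonicalAt u a b n c ξ σ) :
    IsRepresentation u a b n c σ := h.2.elim (fun h => h.1) fun h => h.1.1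

theorem IsCanonicalAt.dblIndex_cases (h : IsCanonicalAt u a b n c ξ σ) :
    dblIndex a b σ.support = n ∨ dblIndex a b σ.support = n + 1 ∧ ξ ∈ Ioo a b :=
  h.2.imp (fun h => (isPrincipal_iff.1 h).2) fun h => ⟨(isCanonical_iff.1 h.1).2, h.2⟩

theorem IsCanonicalAt.dblIndex_erase_lt (h : IsCanonicalAt u a b n c ξ σ) :
    dblIndex a b (σ.support.erase ξ) < n := by
  have h1 := dblIndex_erase (a := a) (b := b) h.1
  rcases h.dblIndex_cases with h2 | ⟨h2, h3⟩
  · split_ifs at h1 <;> omega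
  · rw [if_neg (not_or.2 ⟨h3.1.ne', h3.2.ne⟩)] at h1
    omega

theorem IsCanonicalAt.unique (hab : a < b) (hu : IsCompleteChebyshevSet u a b K) (hn : n ≤ K)
    (hσ : IsCanonicalAt u a b n c ξ σ) (hτ : IsCanonicalAt u a b n c ξ τ) : σ = τ :=
  hσ.isRepresentation.eq_of_dblIndex_erase_lt hab hu hn hτ.isRepresentation
    hσ.dblIndex_erase_lt hτ.dblIndex_erase_lt

/-- The doubled index is at least `n`, and less than `n` without `ξ`. An endpoint contributes one,
which leaves only `n`; an interior point contributes two, which leaves `n` and `n + 1`. -/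
theorem exists_isCanonicalAt (hab : a < b) (hu : IsCompleteChebyshevSet u a b K)
    (hc : HasPositiveMoments u a b K c) (hn0 : 0 < n) (hn : n ≤ K) (hξ : ξ ∈ Icc a b) :
    ∃ σ, IsCanonicalAt u a b n c ξ σ := by
  obtain ⟨σ, hσ, hξσ, hidx⟩ := exists_representation_at hab hu hc hn0 hn hξ
  refine ⟨σ, hξσ, ?_⟩
  have h1 := dblIndex_erase (a := a) (b := b) hξσ
  have h2 := hσ.le_dblIndex hab hu hc hn
  rw [isPrincipal_iff, isCanonical_iff]
  split_ifs at h1 with h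
  · exact Or.inl ⟨hσ, by omega⟩
  · have hξ' : ξ ∈ Ioo a b := ⟨lt_of_le_of_ne hξ.1 fun h' => h (Or.inl h'.symm),
      lt_of_le_of_ne hξ.2 fun h' => h (Or.inr h')⟩
    rcases Nat.lt_or_ge (dblIndex a b σ.support) (n + 1) with h3 | h3
    · exact Or.inl ⟨hσ, by omega⟩
    · exact Or.inr ⟨⟨hσ, by omega⟩, hξ'⟩

theorem IsUpperPrincipal.isCanonicalAt (h : IsUpperPrincipal u a b n c σ) :
    IsCanonicalAt u a b n c b σ := ⟨h.2, Or.inl h.1⟩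

theorem IsUpperPrincipal.unique (hab : a < b) (hu : IsCompleteChebyshevSet u a b K) (hn : n ≤ K)
    (hσ : IsUpperPrincipal u a b n c σ) (hτ : IsUpperPrincipal u a b n c τ) : σ = τ :=
  hσ.isCanonicalAt.unique hab hu hn hτ.isCanonicalAt

/-- Parity of `n` decides whether `a` is a root. If it is, both representations are attached to `a`;
if not, each has `n / 2` roots and the difference lives on at most `n` points. -/
theorem IsLowerPrincipal.unique (hab : a < b) (hu : IsCompleteChebyshevSet u a b K) (hn : n ≤ K)
    (hσ : IsLowerPrincipal u a b n c σ) (hτ : IsLowerPrincipal u a b n c τ) : σ = τ := by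
  have h1 := dblIndex_add_ends hab σ.support
  have h2 := dblIndex_add_ends hab τ.support
  rw [if_neg hσ.2, (isPrincipal_iff.1 hσ.1).2] at h1
  rw [if_neg hτ.2, (isPrincipal_iff.1 hτ.1).2] at h2
  by_cases ha : a ∈ σ.support
  · have ha' : a ∈ τ.support := by
      by_contra ha'
      rw [if_pos ha] at h1
      rw [if_neg ha'] at h2
      omega
    exact IsCanonicalAt.unique hab hu hn ⟨ha, Or.inl hσ.1⟩ ⟨ha', Or.inl hτ.1⟩
  · have ha' : a ∉ τ.support := by
      intro ha'
      rw [if_neg ha] at h1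
      rw [if_pos ha'] at h2
      omega
    rw [if_neg ha] at h1
    rw [if_neg ha'] at h2
    refine hσ.1.1.eq_of_card_le hu hn hτ.1.1 ((Finset.card_union_le _ _).trans ?_)
    omega

/-- There is a principal representation at which the next moment is extremal. -/
theorem exists_extremal_principal (hab : a < b) (hu : IsCompleteChebyshevSet u a b K)
    (hc : HasPositiveMoments u a b K c) (hn0 : 0 < n) (hn : n + 1 ≤ K) {s : ℝ} (hs : s * s = 1) :
    ∃ σ, IsPrincipal u a b n c σ ∧ 0 < s * (c n - pairing σ (u n)) ∧
      ∀ γ ∈ momentRange u a b n c, s * (c n - γ) ≤ s * (c n - pairing σ (u n)) := by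
  -- Moving along the last coordinate keeps the first `n` moments, so the exit distance is the
  -- extremal deviation of the next moment from `c n`.
  set v : Fin (n + 1) → ℝ := Pi.single (Fin.last n) s with hvdef
  have hvlast : v (Fin.last n) = s := by simp [hvdef]
  have hvcast : ∀ j : Fin (n + 1), (j : ℕ) < n → v j = 0 := fun j hj => by
    refine Pi.single_eq_of_ne ?_ _
    rintro rfl
    simp at hj
  have hv : -v ∉ momentCone u a b (n + 1) := by
    rintro ⟨σ, h1, h2, h3⟩
    have h30 := h3 0
    rw [Pi.neg_apply, hvcast 0 (by simpa using hn0), neg_zero] at h30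
    have hz := eq_zero_of_pairing_eq_zero (hu 1 (by omega)) h1 h2 h30
    have h3n := h3 (Fin.last n)
    rw [hz, Pi.neg_apply, hvlast] at h3n
    have : s = 0 := by simpa [pairing] using h3n
    rw [this] at hs
    norm_num at hs
  obtain ⟨ε, hε, ⟨σ, h1, h2, h3⟩, hmax, hidx⟩ :=
    exists_boundary_point hab hu hc (Nat.succ_pos n) hn hv
  have hσ : IsRepresentation u a b n c σ := .of_nonneg h1 h2 fun j hj => by
    have := h3 ⟨j, by omega⟩
    rw [Pi.sub_apply, Pi.smul_apply, hvcast _ hj] at this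
    simpa using this
  have hσn : pairing σ (u n) = c n - ε * s := by
    have := h3 (Fin.last n)
    rw [Pi.sub_apply, Pi.smul_apply, hvlast] at this
    simpa using this
  have hval : s * (c n - pairing σ (u n)) = ε := by
    rw [hσn]; linear_combination ε * hs
  refine ⟨σ, isPrincipal_iff.2 ⟨hσ, ?_⟩, hval ▸ hε, ?_⟩
  · have h4 := hidx σ h1 h2 h3
    have h5 := hσ.le_dblIndex hab hu hc (by omega)
    omega
  · rintro γ ⟨ρ, hρ, hρm, hργ⟩
    rw [hval]
    refine hmax _ ?_
    have := measure_mem_momentCone hab hu (Nat.succ_pos n) hn ρ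
    convert this using 1
    ext j
    rw [Pi.sub_apply, Pi.smul_apply]
    by_cases hj : (j : ℕ) < n
    · rw [hvcast j hj, hρm j hj]; simp
    · have : j = Fin.last n := Fin.ext (by simp; omega)
      rw [this, hvlast, Fin.val_last, hργ, smul_eq_mul]
      linear_combination (γ - c n) * hs

/-- The lower and upper principal representations give the extreme values of the next moment. -/
theorem exists_lower_upper (hab : a < b) (hu : IsCompleteChebyshevSet u a b K)
    (hc : HasPositiveMoments u a b K c) (hn0 : 0 < n) (hn : n + 1 ≤ K) :
    ∃ lo up, IsLowerPrincipal u a b n c lo ∧ IsUpperPrincipal u a b n c up ∧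
      pairing lo (u n) ≠ c n ∧ pairing up (u n) ≠ c n ∧
      c n ∈ uIcc (pairing lo (u n)) (pairing up (u n)) ∧
      momentRange u a b n c ⊆ uIcc (pairing lo (u n)) (pairing up (u n)) := by
  obtain ⟨σ, hσ, hσ1, hσ2⟩ := exists_extremal_principal hab hu hc hn0 hn (s := 1) (by norm_num)
  obtain ⟨τ, hτ, hτ1, hτ2⟩ := exists_extremal_principal hab hu hc hn0 hn (s := -1) (by norm_num)
  have hr : ∀ γ ∈ momentRange u a b n c, γ ∈ Icc (pairing σ (u n)) (pairing τ (u n)) :=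
    fun γ hγ => ⟨by linarith [hσ2 γ hγ], by linarith [hτ2 γ hγ]⟩
  have hlt : pairing σ (u n) < pairing τ (u n) := by linarith
  -- The two extremes lie strictly on either side of `c n`, so uniqueness within each type forces
  -- one upper and one lower representation. Which is which is left open, as the determinants may
  -- have any signs.
  by_cases hb : b ∈ σ.support
  · have hb' : b ∉ τ.support := fun hb' => by
      have := IsUpperPrincipal.unique hab hu (by omega) ⟨hσ, hb⟩ ⟨hτ, hb'⟩
      rw [this] at hlt
      exact lt_irrefl _ hlt
    refine ⟨τ, σ, ⟨hτ, hb'⟩, ⟨hσ, hb⟩, ?_, ?_, ?_, ?_⟩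
    · intro h; linarith
    · intro h; linarith
    · rw [uIcc_of_ge hlt.le]; exact ⟨by linarith, by linarith⟩
    · rw [uIcc_of_ge hlt.le]; exact hr
  · have hb' : b ∈ τ.support := by
      by_contra hb'
      have := IsLowerPrincipal.unique hab hu (by omega) ⟨hσ, hb⟩ ⟨hτ, hb'⟩
      rw [this] at hlt
      exact lt_irrefl _ hlt
    refine ⟨σ, τ, ⟨hσ, hb⟩, ⟨hτ, hb'⟩, ?_, ?_, ?_, ?_⟩
    · intro h; linarith
    · intro h; linarith
    · rw [uIcc_of_le hlt.le]; exact ⟨by linarith, by linarith⟩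
    · rw [uIcc_of_le hlt.le]; exact hr

end representations

/-! ### Discrete measures given by enumerated points and weights -/

section discrete

variable {p : ℕ} {x l : Fin p → ℝ} {σ : ℝ →₀ ℝ}

theorem pairing_discreteMeasure (x l : Fin p → ℝ) (f : ℝ → ℝ) :
    pairing (discreteMeasure x l) f = quadSum f x l := by
  have h : ∀ s : Finset (Fin p), pairing (∑ i ∈ s, Finsupp.single (x i) (l i)) f =
      ∑ i ∈ s, l i * f (x i) := by
    classical
    intro s
    induction s using Finset.induction_on with
    | empty => simp [pairing]
    | insert i s hi ih => rw [Finset.sum_insert hi, Finset.sum_insert hi, pairing_add, ih,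
        pairing_single]
  exact h _

theorem discreteMeasure_apply (hx : Function.Injective x) (i : Fin p) :
    discreteMeasure x l (x i) = l i := by
  classical
  rw [discreteMeasure, Finsupp.finsetSum_apply, Finset.sum_eq_single i]
  · simp
  · intro j _ hj
    exact Finsupp.single_eq_of_ne fun h => hj (hx h.symm)
  · simp

theorem discreteMeasure_apply_of_notMem {t : ℝ} (ht : t ∉ Set.range x) :
    discreteMeasure x l t = 0 := by
  classical
  rw [discreteMeasure, Finsupp.finsetSum_apply]
  exact Finset.sum_eq_zero fun j _ => Finsupp.single_eq_of_ne fun h => ht ⟨j, h.symm⟩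

theorem support_discreteMeasure_subset :
    (discreteMeasure x l).support ⊆ Finset.univ.image x := by
  intro t ht
  by_contra h
  refine Finsupp.mem_support_iff.1 ht (discreteMeasure_apply_of_notMem fun ⟨i, hi⟩ => h ?_)
  exact Finset.mem_image.2 ⟨i, Finset.mem_univ _, hi⟩

theorem discreteMeasure_nonneg (hl : ∀ i, 0 ≤ l i) (t : ℝ) : 0 ≤ discreteMeasure x l t := by
  classical
  rw [discreteMeasure, Finsupp.finsetSum_apply]
  refine Finset.sum_nonneg fun i _ => ?_
  rw [Finsupp.single_apply]
  split_ifs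
  · exact hl i
  · exact le_rfl

theorem discreteMeasure_self (hx : Function.Injective x) (hσ : σ.support ⊆ Finset.univ.image x) :
    discreteMeasure x (fun i => σ (x i)) = σ := by
  ext t
  by_cases ht : t ∈ Set.range x
  · obtain ⟨i, rfl⟩ := ht
    exact discreteMeasure_apply hx i
  · rw [discreteMeasure_apply_of_notMem ht, eq_comm, ← Finsupp.notMem_support_iff]
    intro h
    obtain ⟨i, -, hi⟩ := Finset.mem_image.1 (hσ h)
    exact ht ⟨i, hi⟩

theorem StrictMono.eq_of_image_eq {x y : Fin p → ℝ} (hx : StrictMono x) (hy : StrictMono y)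
    (h : Finset.univ.image x = Finset.univ.image y) : x = y := by
  refine (hx.range_inj hy).1 ?_
  have := congrArg (fun s : Finset ℝ => (s : Set ℝ)) h
  simpa using this

end discrete

theorem IsRepresentation.pairing_mem_momentRange {u : ℕ → ℝ → ℝ} {a b : ℝ} {n : ℕ} {c : ℕ → ℝ}
    {σ : ℝ →₀ ℝ} (hσ : IsRepresentation u a b n c σ) :
    pairing σ (u n) ∈ momentRange u a b n c := by
  classical
  set ρ : Measure ℝ := ∑ t ∈ σ.support, ENNReal.ofReal (σ t) • Measure.dirac t with hρ
  have hint : ∀ f : ℝ → ℝ, ∫ t in Icc a b, f t ∂ρ = pairing σ f := by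
    intro f
    have hres : ρ.restrict (Icc a b) = ρ := by
      refine Measure.restrict_eq_self_of_ae_mem ?_
      rw [ae_iff, hρ, Measure.finsetSum_apply]
      refine Finset.sum_eq_zero fun t ht => ?_
      have htI := hσ.mem_Icc t ht
      rw [Measure.smul_apply, Measure.dirac_apply]
      have : t ∉ {x | x ∉ Icc a b} := fun h => h htI
      rw [indicator_of_notMem this, smul_zero]
    rw [hres, hρ, integral_finsetSum_measure, pairing_eq_sum (subset_refl _)]
    · refine Finset.sum_congr rfl fun t ht => ?_
      rw [integral_smul_measure, integral_dirac, ENNReal.toReal_ofReal (hσ.nonneg t), smul_eq_mul]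
    · intro t ht
      exact (integrable_dirac (by simp)).smul_measure ENNReal.ofReal_ne_top
  refine ⟨ρ, ⟨?_⟩, fun j hj => (hint _).trans (hσ.moment j hj), hint _⟩
  rw [hρ, Measure.finsetSum_apply]
  refine ENNReal.sum_lt_top.2 fun t _ => ?_
  simp

/-! ### One-parameter families of canonical representations -/

/-- A choice `s` of canonical representations attached to the points of `[a, β]`, whose roots,
completed by the points of `E ⊆ {b}`, are enumerated by `X`. -/
structure IsCanonicalSelection (u : ℕ → ℝ → ℝ) (a b : ℝ) (n : ℕ) (c : ℕ → ℝ) (β : ℝ) {k : ℕ}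
    (E : Finset ℝ) (s : ℝ → ℝ →₀ ℝ) (X : ℝ → Fin (k + 1) → ℝ) : Prop where
  isCanonicalAt : ∀ ξ ∈ Icc a β, IsCanonicalAt u a b n c ξ (s ξ)
  strictMono : ∀ ξ ∈ Icc a β, StrictMono (X ξ)
  first : ∀ ξ ∈ Icc a β, X ξ 0 = ξ
  image_eq : ∀ ξ ∈ Icc a β, Finset.univ.image (X ξ) = (s ξ).support ∪ E
  subset_singleton : E ⊆ {b}
  le_card : 2 * k + 1 ≤ n + E.card

namespace IsCanonicalSelection

variable {u : ℕ → ℝ → ℝ} {a b : ℝ} {n K : ℕ} {c : ℕ → ℝ} {β : ℝ} {k : ℕ} {E : Finset ℝ}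
  {s : ℝ → ℝ →₀ ℝ} {X : ℝ → Fin (k + 1) → ℝ} {ξ ξ' : ℝ}

theorem support_subset (h : IsCanonicalSelection u a b n c β E s X) (hξ : ξ ∈ Icc a β) :
    (s ξ).support ⊆ Finset.univ.image (X ξ) := by
  rw [h.image_eq ξ hξ]; exact Finset.subset_union_left

theorem discreteMeasure_eq (h : IsCanonicalSelection u a b n c β E s X) (hξ : ξ ∈ Icc a β) :
    discreteMeasure (X ξ) (fun i => s ξ (X ξ i)) = s ξ :=
  discreteMeasure_self (h.strictMono ξ hξ).injective (h.support_subset hξ)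

theorem quadSum_eq (h : IsCanonicalSelection u a b n c β E s X) (hξ : ξ ∈ Icc a β) (f : ℝ → ℝ) :
    quadSum f (X ξ) (fun i => s ξ (X ξ i)) = pairing (s ξ) f := by
  rw [← pairing_discreteMeasure, h.discreteMeasure_eq hξ]

theorem point_mem_Icc (h : IsCanonicalSelection u a b n c β E s X) (hab : a < b)
    (hξ : ξ ∈ Icc a β) (i : Fin (k + 1)) : X ξ i ∈ Icc a b := by
  have : X ξ i ∈ (s ξ).support ∪ E := by
    rw [← h.image_eq ξ hξ]; exact Finset.mem_image_of_mem _ (Finset.mem_univ i)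
  rcases Finset.mem_union.1 this with h' | h'
  · exact (h.isCanonicalAt ξ hξ).isRepresentation.mem_Icc _ h'
  · rw [Finset.mem_singleton.1 (h.subset_singleton h')]
    exact right_mem_Icc.2 hab.le

theorem last_eq (h : IsCanonicalSelection u a b n c β E s X) (hab : a < b)
    (hξ : ξ ∈ Icc a β) (hb : b ∈ E) : X ξ (Fin.last k) = b := by
  have : b ∈ Finset.univ.image (X ξ) := by
    rw [h.image_eq ξ hξ]; exact Finset.mem_union_right _ hb
  obtain ⟨i, -, hi⟩ := Finset.mem_image.1 this
  refine le_antisymm (h.point_mem_Icc hab hξ _).2 ?_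
  rw [← hi]
  exact (h.strictMono ξ hξ).monotone (Fin.le_last i)

theorem le_of_mem_support (h : IsCanonicalSelection u a b n c β E s X) (hξ : ξ ∈ Icc a β)
    {t : ℝ} (ht : t ∈ Finset.univ.image (X ξ)) : ξ ≤ t := by
  obtain ⟨i, -, rfl⟩ := Finset.mem_image.1 ht
  calc ξ = X ξ 0 := (h.first ξ hξ).symm
    _ ≤ X ξ i := (h.strictMono ξ hξ).monotone (Fin.zero_le i)

theorem notMem_support_of_lt (h : IsCanonicalSelection u a b n c β E s X) (hξ' : ξ' ∈ Icc a β)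
    (hlt : ξ < ξ') : ξ ∉ (s ξ').support := fun hmem =>
  not_le.2 hlt (h.le_of_mem_support hξ' (h.support_subset hξ' hmem))

theorem ne_of_lt (h : IsCanonicalSelection u a b n c β E s X) (hξ : ξ ∈ Icc a β)
    (hξ' : ξ' ∈ Icc a β) (hlt : ξ < ξ') : s ξ ≠ s ξ' := fun heq =>
  h.notMem_support_of_lt hξ' hlt (heq ▸ (h.isCanonicalAt ξ hξ).1)

theorem card_union_add (h : IsCanonicalSelection u a b n c β E s X) (hξ : ξ ∈ Icc a β)
    (hξ' : ξ' ∈ Icc a β) :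
    (Finset.univ.image (X ξ) ∪ Finset.univ.image (X ξ')).card +
      (Finset.univ.image (X ξ) ∩ Finset.univ.image (X ξ')).card = 2 * k + 2 := by
  rw [Finset.card_union_add_card_inter,
    Finset.card_image_of_injective _ (h.strictMono ξ hξ).injective,
    Finset.card_image_of_injective _ (h.strictMono ξ' hξ').injective, Finset.card_univ,
    Fintype.card_fin]
  ring

theorem subset_inter (h : IsCanonicalSelection u a b n c β E s X) (hξ : ξ ∈ Icc a β)
    (hξ' : ξ' ∈ Icc a β) : E ⊆ Finset.univ.image (X ξ) ∩ Finset.univ.image (X ξ') := by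
  rw [h.image_eq ξ hξ, h.image_eq ξ' hξ']
  exact Finset.subset_inter Finset.subset_union_right Finset.subset_union_right

/-- The node sets share `E`, so the union has at most `2 * k + 2 - E.card` points. The field
`le_card` brings this down to `n + 1`, the largest number for which alternation holds. -/
theorem card_union_le (h : IsCanonicalSelection u a b n c β E s X) (hξ : ξ ∈ Icc a β)
    (hξ' : ξ' ∈ Icc a β) :
    (Finset.univ.image (X ξ) ∪ Finset.univ.image (X ξ')).card ≤ n + 1 := by
  have h1 := h.card_union_add hξ hξ'
  have h2 := Finset.card_le_card (h.subset_inter hξ hξ')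
  have h3 := h.le_card
  omega

theorem union_subset_union (h : IsCanonicalSelection u a b n c β E s X) (hξ : ξ ∈ Icc a β)
    (hξ' : ξ' ∈ Icc a β) : (s ξ).support ∪ (s ξ').support ⊆
      Finset.univ.image (X ξ) ∪ Finset.univ.image (X ξ') :=
  Finset.union_subset_union (h.support_subset hξ) (h.support_subset hξ')

theorem union_mem_Icc (h : IsCanonicalSelection u a b n c β E s X) (hab : a < b)
    (hξ : ξ ∈ Icc a β) (hξ' : ξ' ∈ Icc a β) :
    ∀ t ∈ Finset.univ.image (X ξ) ∪ Finset.univ.image (X ξ'), t ∈ Icc a b := by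
  intro t ht
  rcases Finset.mem_union.1 ht with ht | ht <;> obtain ⟨i, -, rfl⟩ := Finset.mem_image.1 ht
  · exact h.point_mem_Icc hab hξ i
  · exact h.point_mem_Icc hab hξ' i

/-- The moving points are strictly increasing functions of the first point. -/
theorem point_lt (h : IsCanonicalSelection u a b n c β E s X) (hab : a < b)
    (hu : IsCompleteChebyshevSet u a b K) (hn : n ≤ K) (hξ : ξ ∈ Icc a β)
    (hξ' : ξ' ∈ Icc a β) (hlt : ξ < ξ') (i : Fin (k + 1)) (hi : X ξ' i ∉ E) :
    X ξ i < X ξ' i := by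
  have hR := (h.isCanonicalAt ξ hξ).isRepresentation
  have hR' := (h.isCanonicalAt ξ' hξ').isRepresentation
  -- A common node outside `E` would leave at most `n` points in the union and force the two
  -- measures to agree.
  have hpos : ∀ i, X ξ' i ∉ E → 0 < (s ξ' - s ξ) (X ξ' i) := by
    intro i hi
    have himg : X ξ' i ∈ Finset.univ.image (X ξ') :=
      Finset.mem_image_of_mem _ (Finset.mem_univ i)
    have hs' : X ξ' i ∈ (s ξ').support := by
      rw [h.image_eq ξ' hξ'] at himg
      exact (Finset.mem_union.1 himg).resolve_right hi
    have hs : X ξ' i ∉ (s ξ).support := by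
      intro hs
      have hsub : insert (X ξ' i) E ⊆
          Finset.univ.image (X ξ) ∩ Finset.univ.image (X ξ') :=
        Finset.insert_subset (Finset.mem_inter.2 ⟨h.support_subset hξ hs, himg⟩)
          (h.subset_inter hξ hξ')
      have h1 := Finset.card_le_card hsub
      rw [Finset.card_insert_of_notMem hi] at h1
      have h2 := h.card_union_add hξ hξ'
      have h3 := h.le_card
      refine h.ne_of_lt hξ hξ' hlt (hR.eq_of_card_le hu hn hR' ?_)
      have := Finset.card_le_card (h.union_subset_union hξ hξ')
      omega
    rw [Finsupp.sub_apply, Finsupp.notMem_support_iff.1 hs, sub_zero]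
    exact hR'.pos _ hs'
  induction i using Fin.induction with
  | zero => rw [h.first ξ hξ, h.first ξ' hξ']; exact hlt
  | succ i ih =>
    have hstep := h.strictMono ξ' hξ' (Fin.castSucc_lt_succ (i := i))
    have hi' : X ξ' i.castSucc ∉ E := by
      intro hE
      have h1 := Finset.mem_singleton.1 (h.subset_singleton hE)
      have h2 := (h.point_mem_Icc hab hξ' i.succ).2
      linarith
    -- Between two consecutive nodes at `ξ'` there is a root at `ξ`; by induction it comes after the
    -- node `i` at `ξ`, so node `i + 1` at `ξ` is not beyond it.
    obtain ⟨x, hx1, hx2, hx⟩ := exists_neg_between hu hn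
      (h.union_mem_Icc hab hξ' hξ) ((support_sub_subset _ _).trans (h.union_subset_union hξ' hξ))
      (hR'.pairing_sub_eq_zero hR) (h.card_union_le hξ' hξ) hstep (hpos _ hi') (hpos _ hi)
    have hxs : x ∈ (s ξ).support := by
      rw [Finsupp.sub_apply] at hx
      have := hR'.nonneg x
      refine Finsupp.mem_support_iff.2 fun h0 => ?_
      linarith
    obtain ⟨j, -, rfl⟩ := Finset.mem_image.1 (h.support_subset hξ hxs)
    have hij : i.castSucc < j := (h.strictMono ξ hξ).lt_iff_lt.1 ((ih hi').trans hx1)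
    exact ((h.strictMono ξ hξ).monotone (Fin.castSucc_lt_iff_succ_le.1 hij)).trans_lt hx2

/-- The next discrete moment is strictly monotone. -/
theorem moment_sign {e e' : ℝ} (h : IsCanonicalSelection u a b n c β E s X) (hab : a < b)
    (hu : IsCompleteChebyshevSet u a b K) (hn : n + 1 ≤ K)
    (he : ∀ t : Fin n → ℝ, StrictMono t → (∀ i, t i ∈ Icc a b) → 0 < e * chebDet u n t)
    (he' : ∀ t : Fin (n + 1) → ℝ, StrictMono t → (∀ i, t i ∈ Icc a b) →
      0 < e' * chebDet u (n + 1) t)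
    (hξ : ξ ∈ Icc a β) (hξ' : ξ' ∈ Icc a β) (hlt : ξ < ξ') :
    0 < e * e' * (-1) ^ n * (pairing (s ξ) (u n) - pairing (s ξ') (u n)) := by
  rw [← pairing_sub]
  refine next_moment_sign hn hu he he' (h.union_mem_Icc hab hξ hξ')
    ((support_sub_subset _ _).trans (h.union_subset_union hξ hξ'))
    ((h.isCanonicalAt ξ hξ).isRepresentation.pairing_sub_eq_zero
      (h.isCanonicalAt ξ' hξ').isRepresentation) (h.card_union_le hξ hξ') (s := ξ) ?_ ?_
  · rw [Finsupp.sub_apply, Finsupp.notMem_support_iff.1 (h.notMem_support_of_lt hξ' hlt),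
      sub_zero]
    exact (h.isCanonicalAt ξ hξ).isRepresentation.pos _ (h.isCanonicalAt ξ hξ).1
  · intro t ht
    rcases Finset.mem_union.1 ht with ht | ht
    · exact h.le_of_mem_support hξ ht
    · exact hlt.le.trans (h.le_of_mem_support hξ' ht)

/-- On `[a, b]` the function `e * u 0` has a positive minimum, while its integral against each `s ξ`
is the fixed number `e * c 0`. -/
theorem exists_weight_bound (h : IsCanonicalSelection u a b n c β E s X) (hab : a < b)
    (hu : IsChebyshevSet u a b 1) (hn : 0 < n) :
    ∃ B, ∀ ξ ∈ Icc a β, ∀ t, s ξ t ≤ B := by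
  obtain ⟨e, he⟩ := hu.exists_sign_first
  obtain ⟨t₀, ht₀, hmin⟩ := isCompact_Icc.exists_isMinOn (nonempty_Icc.2 hab.le)
    (continuousOn_const.mul (hu.1 0 (by omega)) : ContinuousOn (fun t => e * u 0 t) (Icc a b))
  refine ⟨e * c 0 / (e * u 0 t₀), fun ξ hξ t => ?_⟩
  have hR := (h.isCanonicalAt ξ hξ).isRepresentation
  have hterm : ∀ t ∈ (s ξ).support, 0 ≤ s ξ t * (e * u 0 t) := fun t ht =>
    mul_nonneg (hR.nonneg t) (he t (hR.mem_Icc t ht)).le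
  have hsum : e * c 0 = ∑ t ∈ (s ξ).support, s ξ t * (e * u 0 t) := by
    have h0 : pairing (s ξ) (u 0) = c 0 := hR.moment 0 hn
    rw [← h0, pairing_eq_sum (subset_refl _), Finset.mul_sum]
    exact Finset.sum_congr rfl fun t _ => by ring
  rw [le_div_iff₀ (he t₀ ht₀), hsum]
  by_cases ht : t ∈ (s ξ).support
  · refine le_trans ?_ (Finset.single_le_sum hterm ht)
    exact mul_le_mul_of_nonneg_left (hmin (hR.mem_Icc t ht)) (hR.nonneg t)
  · rw [Finsupp.notMem_support_iff.1 ht, zero_mul]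
    exact Finset.sum_nonneg hterm

/-- In a limit nodes may merge and weights may vanish, but this only lowers the index: the `k` nodes
after the first, with `b` among them if `b ∈ E`, still have doubled index below `n`. Uniqueness
identifies the limit with `s ξ`, and counting nodes then excludes mergers. -/
theorem eq_of_limit (h : IsCanonicalSelection u a b n c β E s X) (hab : a < b)
    (hu : IsCompleteChebyshevSet u a b K) (hn : n ≤ K) (hk : 0 < k) (hξ : ξ ∈ Icc a β)
    {x l : Fin (k + 1) → ℝ} (hx : Monotone x) (hxI : ∀ i, x i ∈ Icc a b) (hl : ∀ i, 0 ≤ l i)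
    (hx0 : x 0 = ξ) (hxb : b ∈ E → x (Fin.last k) = b) (hm : ∀ j < n, quadSum (u j) x l = c j) :
    x = X ξ ∧ l = fun i => s ξ (X ξ i) := by
  classical
  have hR : IsRepresentation u a b n c (discreteMeasure x l) := by
    refine .of_nonneg (fun t ht => ?_) (discreteMeasure_nonneg hl) fun j hj => ?_
    · obtain ⟨i, -, rfl⟩ := Finset.mem_image.1 (support_discreteMeasure_subset ht)
      exact hxI i
    · rw [pairing_discreteMeasure, hm j hj]
  have hidx : dblIndex a b ((discreteMeasure x l).support.erase ξ) < n := by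
    set W := (Finset.univ.erase (0 : Fin (k + 1))).image x with hW
    have hsub : (discreteMeasure x l).support.erase ξ ⊆ W := by
      intro t ht
      obtain ⟨h1, h2⟩ := Finset.mem_erase.1 ht
      obtain ⟨i, -, rfl⟩ := Finset.mem_image.1 (support_discreteMeasure_subset h2)
      refine Finset.mem_image_of_mem _ (Finset.mem_erase.2 ⟨?_, Finset.mem_univ _⟩)
      rintro rfl
      exact h1 hx0
    have hWc : W.card ≤ k := by
      refine Finset.card_image_le.trans ?_
      rw [Finset.card_erase_of_mem (Finset.mem_univ _), Finset.card_univ, Fintype.card_fin]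
      omega
    have h1 := dblIndex_add_ends hab W
    have h2 := dblIndex_mono (a := a) (b := b) hsub
    have h3 := h.le_card
    by_cases hbE : b ∈ E
    · have hbW : b ∈ W := by
        rw [← hxb hbE]
        refine Finset.mem_image_of_mem _ (Finset.mem_erase.2 ⟨?_, Finset.mem_univ _⟩)
        exact fun h0 => hk.ne' (by simpa using congrArg Fin.val h0)
      have h4 := Finset.card_le_card h.subset_singleton
      rw [Finset.card_singleton] at h4
      rw [if_pos hbW] at h1
      omega
    · have h4 : E = ∅ := Finset.eq_empty_of_forall_notMem fun t ht =>
        hbE (Finset.mem_singleton.1 (h.subset_singleton ht) ▸ ht)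
      rw [h4, Finset.card_empty] at h3
      omega
  have heq : discreteMeasure x l = s ξ :=
    hR.eq_of_dblIndex_erase_lt hab hu hn (h.isCanonicalAt ξ hξ).isRepresentation hidx
      (h.isCanonicalAt ξ hξ).dblIndex_erase_lt
  have hsub : Finset.univ.image (X ξ) ⊆ Finset.univ.image x := by
    rw [h.image_eq ξ hξ, ← heq]
    refine Finset.union_subset support_discreteMeasure_subset fun t ht => ?_
    have htb := Finset.mem_singleton.1 (h.subset_singleton ht)
    rw [htb, ← hxb (htb ▸ ht)]
    exact Finset.mem_image_of_mem _ (Finset.mem_univ _)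
  have hcX : (Finset.univ.image (X ξ)).card = k + 1 := by
    rw [Finset.card_image_of_injective _ (h.strictMono ξ hξ).injective, Finset.card_univ,
      Fintype.card_fin]
  have hcx : (Finset.univ.image x).card ≤ k + 1 := by
    refine Finset.card_image_le.trans ?_
    rw [Finset.card_univ, Fintype.card_fin]
  have himg : Finset.univ.image (X ξ) = Finset.univ.image x :=
    Finset.eq_of_subset_of_card_le hsub (by omega)
  have hinj : Function.Injective x := by
    have hinjOn : Set.InjOn x (Finset.univ : Finset (Fin (k + 1))) := Finset.card_image_iff.1 (by
      rw [← himg, hcX, Finset.card_univ, Fintype.card_fin])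
    exact fun i j hij => hinjOn (by simp) (by simp) hij
  have hxX : x = X ξ :=
    (hx.strictMono_of_injective hinj).eq_of_image_eq (h.strictMono ξ hξ) himg.symm
  refine ⟨hxX, funext fun i => ?_⟩
  rw [← heq, ← hxX, discreteMeasure_apply hinj]

/-- Nodes and weights stay in a compact set, and every subsequential limit is the value at `ξ` by
`eq_of_limit`. -/
theorem continuousOn (h : IsCanonicalSelection u a b n c β E s X) (hab : a < b)
    (hu : IsCompleteChebyshevSet u a b K) (hn : n ≤ K) (hn0 : 0 < n) (hk : 0 < k) :
    ContinuousOn (fun ξ => (X ξ, fun i => s ξ (X ξ i))) (Icc a β) := by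
  obtain ⟨B, hB⟩ := h.exists_weight_bound hab (hu 1 (by omega)) hn0
  intro ξ hξ
  refine Filter.tendsto_of_subseq_tendsto fun ns hns => ?_
  have hev : ∀ᶠ m in Filter.atTop, ns m ∈ Icc a β :=
    (tendsto_nhdsWithin_iff.1 hns).2
  have hcomp : IsCompact ((Set.pi univ fun _ : Fin (k + 1) => Icc a b) ×ˢ
      (Set.pi univ fun _ : Fin (k + 1) => Icc 0 B)) :=
    (isCompact_univ_pi fun _ => isCompact_Icc).prod (isCompact_univ_pi fun _ => isCompact_Icc)
  obtain ⟨⟨x, l⟩, ⟨hxI, hlI⟩, φ, hφ, hlim⟩ := hcomp.tendsto_subseq'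
    (x := fun m => (X (ns m), fun i => s (ns m) (X (ns m) i)))
    (hev.mono fun m hm => ⟨fun i _ => h.point_mem_Icc hab hm i, fun i _ =>
      ⟨(h.isCanonicalAt _ hm).isRepresentation.nonneg _, hB _ hm _⟩⟩).frequently
  refine ⟨φ, ?_⟩
  have hev' : ∀ᶠ m in Filter.atTop, ns (φ m) ∈ Icc a β := hφ.tendsto_atTop.eventually hev
  have hx : ∀ i, Filter.Tendsto (fun m => X (ns (φ m)) i) Filter.atTop (nhds (x i)) := fun i =>
    (((continuous_apply i).comp continuous_fst).tendsto (x, l)).comp hlim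
  have hl : ∀ i, Filter.Tendsto (fun m => s (ns (φ m)) (X (ns (φ m)) i)) Filter.atTop
      (nhds (l i)) := fun i =>
    (((continuous_apply i).comp continuous_snd).tendsto (x, l)).comp hlim
  have hmono : Monotone x := fun i j hij =>
    le_of_tendsto_of_tendsto (hx i) (hx j) (hev'.mono fun m hm => (h.strictMono _ hm).monotone hij)
  have hx0 : x 0 = ξ := by
    refine tendsto_nhds_unique (hx 0) ?_
    refine (((tendsto_nhdsWithin_iff.1 hns).1).comp hφ.tendsto_atTop).congr' ?_
    exact hev'.mono fun m hm => (h.first _ hm).symm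
  have hxb : b ∈ E → x (Fin.last k) = b := fun hb =>
    tendsto_nhds_unique (hx _) (tendsto_const_nhds.congr' (hev'.mono fun m hm =>
      (h.last_eq hab hm hb).symm))
  have hm : ∀ j < n, quadSum (u j) x l = c j := by
    intro j hj
    have hux : ∀ i, Filter.Tendsto (fun m => u j (X (ns (φ m)) i)) Filter.atTop
        (nhds (u j (x i))) := fun i =>
      (((hu n hn).1 j hj) (x i) (hxI i (mem_univ i))).tendsto.comp
        (tendsto_nhdsWithin_iff.2 ⟨hx i, hev'.mono fun m hm => h.point_mem_Icc hab hm i⟩)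
    refine tendsto_nhds_unique (tendsto_finsetSum _ fun i _ => (hl i).mul (hux i))
      (tendsto_const_nhds.congr' (hev'.mono fun m hm => ?_))
    rw [← (h.isCanonicalAt _ hm).isRepresentation.moment j hj]
    exact (h.quadSum_eq hm (u j)).symm
  obtain ⟨h1, h2⟩ := h.eq_of_limit hab hu hn hk hξ hmono (fun i => hxI i (mem_univ i))
    (fun i => (hlI i (mem_univ i)).1) hx0 hxb hm
  have h3 : l = fun i => s ξ (X ξ i) := h2
  rw [h1, h3] at hlim
  exact hlim

theorem isCanonicalFamily (h : IsCanonicalSelection u a b n c β E s X) (hab : a < b)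
    (hu : IsCompleteChebyshevSet u a b K) (hn : n ≤ K) (hn0 : 0 < n) (hk : 0 < k) :
    IsCanonicalFamily u a b n c β X (fun ξ i => s ξ (X ξ i)) where
  continuousOn_points := continuous_fst.comp_continuousOn (h.continuousOn hab hu hn hn0 hk)
  continuousOn_weights := continuous_snd.comp_continuousOn (h.continuousOn hab hu hn hn0 hk)
  strictMono := h.strictMono
  first := h.first
  canonical_iff ξ hξ σ := by
    rw [h.discreteMeasure_eq hξ]
    exact ⟨fun hσ => hσ.unique hab hu hn (h.isCanonicalAt ξ hξ),
      fun hσ => hσ ▸ h.isCanonicalAt ξ hξ⟩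

theorem continuousOn_moment (h : IsCanonicalSelection u a b n c β E s X) (hab : a < b)
    (hu : IsCompleteChebyshevSet u a b K) (hn : n + 1 ≤ K) (hn0 : 0 < n) (hk : 0 < k) :
    ContinuousOn (fun ξ => quadSum (u n) (X ξ) (fun i => s ξ (X ξ i))) (Icc a β) := by
  have hc := h.continuousOn hab hu (by omega) hn0 hk
  refine continuousOn_finsetSum _ fun i _ => ContinuousOn.mul ?_ ?_
  · exact ((continuous_apply i).comp continuous_snd).comp_continuousOn hc
  · exact ((hu (n + 1) hn).1 n (by omega)).comp
      (((continuous_apply i).comp continuous_fst).comp_continuousOn hc)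
      fun ξ hξ => h.point_mem_Icc hab hξ i

theorem strictAntiOn_or_strictMonoOn (h : IsCanonicalSelection u a b n c β E s X) (hab : a < b)
    (hu : IsCompleteChebyshevSet u a b K) (hn : n + 1 ≤ K) :
    StrictAntiOn (fun ξ => quadSum (u n) (X ξ) (fun i => s ξ (X ξ i))) (Icc a β) ∨
      StrictMonoOn (fun ξ => quadSum (u n) (X ξ) (fun i => s ξ (X ξ i))) (Icc a β) := by
  obtain ⟨e, he⟩ := (hu n (by omega)).exists_sign
  obtain ⟨e', he'⟩ := (hu (n + 1) hn).exists_sign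
  rcases le_or_gt 0 (e * e' * (-1) ^ n) with hs | hs
  · refine Or.inl fun ξ hξ ξ' hξ' hlt => ?_
    have := h.moment_sign hab hu hn he he' hξ hξ' hlt
    simp only [h.quadSum_eq hξ, h.quadSum_eq hξ']
    linarith [pos_of_mul_pos_right this hs]
  · refine Or.inr fun ξ hξ ξ' hξ' hlt => ?_
    have := h.moment_sign hab hu hn he he' hξ hξ' hlt
    simp only [h.quadSum_eq hξ, h.quadSum_eq hξ']
    linarith [neg_of_mul_pos_right this hs.le]

theorem moment_sign_of_isPositivelyOriented (h : IsCanonicalSelection u a b n c β E s X)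
    (hab : a < b) (hu : IsCompleteChebyshevSet u a b K) (hn : n + 1 ≤ K)
    (hpos : IsPositivelyOriented u a b K) (hξ : ξ ∈ Icc a β) (hξ' : ξ' ∈ Icc a β) (hlt : ξ < ξ') :
    0 < (-1) ^ n * (quadSum (u n) (X ξ) (fun i => s ξ (X ξ i)) -
      quadSum (u n) (X ξ') (fun i => s ξ' (X ξ' i))) := by
  have := h.moment_sign hab hu hn (e := 1) (e' := 1)
    (fun t ht hI => by rw [one_mul]; exact hpos n (by omega) t ht hI)
    (fun t ht hI => by rw [one_mul]; exact hpos _ hn t ht hI) hξ hξ' hlt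
  rw [h.quadSum_eq hξ, h.quadSum_eq hξ']
  simpa using this

/-- The discrete moment sweeps out the whole range and takes the value `c n` exactly once. -/
theorem image_eq_and_exists_unique (h : IsCanonicalSelection u a b n c β E s X) (hab : a < b)
    (haβ : a < β) (hu : IsCompleteChebyshevSet u a b K) (hc : HasPositiveMoments u a b K c)
    (hn : n + 1 ≤ K) (hn0 : 0 < n) (hk : 0 < k)
    (hends : IsUpperPrincipal u a b n c (s a) ∧ IsLowerPrincipal u a b n c (s β) ∨
      IsLowerPrincipal u a b n c (s a) ∧ IsUpperPrincipal u a b n c (s β)) :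
    (fun ξ => quadSum (u n) (X ξ) (fun i => s ξ (X ξ i))) '' Icc a β = momentRange u a b n c ∧
      ∃ ξ₁ ∈ Ioo a β, ∀ ξ ∈ Icc a β,
        quadSum (u n) (X ξ) (fun i => s ξ (X ξ i)) = c n ↔ ξ = ξ₁ := by
  set μ := fun ξ => quadSum (u n) (X ξ) (fun i => s ξ (X ξ i)) with hμ
  have haI : a ∈ Icc a β := left_mem_Icc.2 haβ.le
  have hβI : β ∈ Icc a β := right_mem_Icc.2 haβ.le
  obtain ⟨lo, up, hlo, hup, hlon, hupn, hmem, hrange⟩ := exists_lower_upper hab hu hc hn0 hn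
  -- By uniqueness the ends of the family are the principal representations that bound the moment
  -- range, so the intermediate value theorem covers all of it.
  have key : μ a ≠ c n ∧ μ β ≠ c n ∧ c n ∈ uIcc (μ a) (μ β) ∧
      momentRange u a b n c ⊆ uIcc (μ a) (μ β) := by
    simp only [hμ, h.quadSum_eq haI, h.quadSum_eq hβI]
    rcases hends with ⟨h1, h2⟩ | ⟨h1, h2⟩
    · rw [h1.unique hab hu (by omega) hup, h2.unique hab hu (by omega) hlo, uIcc_comm]
      exact ⟨hupn, hlon, hmem, hrange⟩
    · rw [h1.unique hab hu (by omega) hlo, h2.unique hab hu (by omega) hup]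
      exact ⟨hlon, hupn, hmem, hrange⟩
  obtain ⟨k1, k2, k3, k4⟩ := key
  have hivt : uIcc (μ a) (μ β) ⊆ μ '' Icc a β := by
    have := intermediate_value_uIcc (f := μ) (a := a) (b := β) (by
      rw [uIcc_of_le haβ.le]; exact h.continuousOn_moment hab hu hn hn0 hk)
    rwa [uIcc_of_le haβ.le] at this
  refine ⟨Subset.antisymm ?_ (k4.trans hivt), ?_⟩
  · rintro _ ⟨ξ, hξ, rfl⟩
    simp only [hμ, h.quadSum_eq hξ]
    exact (h.isCanonicalAt ξ hξ).isRepresentation.pairing_mem_momentRange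
  · obtain ⟨ξ₁, hξ₁, hval⟩ := hivt k3
    refine ⟨ξ₁, ⟨lt_of_le_of_ne hξ₁.1 ?_, lt_of_le_of_ne hξ₁.2 ?_⟩, fun ξ hξ => ⟨fun hv => ?_, ?_⟩⟩
    · rintro rfl; exact k1 hval
    · rintro rfl; exact k2 hval
    · have hinj : Set.InjOn μ (Icc a β) := by
        rcases h.strictAntiOn_or_strictMonoOn hab hu hn with hs | hs
        · exact hs.injOn
        · exact hs.injOn
      exact hinj hξ hξ₁ (hv.trans hval.symm)
    · rintro rfl; exact hval

end IsCanonicalSelection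

/-! ### Position and number of the roots -/

section structure_of_roots

variable {u : ℕ → ℝ → ℝ} {a b : ℝ} {n K k : ℕ} {c : ℕ → ℝ} {σ τ : ℝ →₀ ℝ} {ξ : ℝ}

/-- Two roots of `σ` to the left of all roots of `τ` would be positive masses of `σ - τ`; the
negative mass between them would be a root of `τ`. -/
theorem IsRepresentation.not_two_roots_below (hu : IsCompleteChebyshevSet u a b K) (hn : n ≤ K)
    (hσ : IsRepresentation u a b n c σ) (hτ : IsRepresentation u a b n c τ)
    (hcard : (σ.support ∪ τ.support).card ≤ n + 1) {x y : ℝ} (hx : x ∈ σ.support)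
    (hy : y ∈ σ.support) (hxy : x < y) (hyτ : ∀ t ∈ τ.support, y < t) : False := by
  have hpos : ∀ z ∈ σ.support, z ≤ y → 0 < (σ - τ) z := fun z hz hzy => by
    rw [Finsupp.sub_apply, Finsupp.notMem_support_iff.1 fun h => not_lt.2 hzy (hyτ z h), sub_zero]
    exact hσ.pos z hz
  obtain ⟨z, -, hz2, hz⟩ := exists_neg_between hu hn (hσ.union_subset hτ)
    (support_sub_subset σ τ) (hσ.pairing_sub_eq_zero hτ) hcard hxy (hpos x hx hxy.le)
    (hpos y hy le_rfl)
  rw [Finsupp.sub_apply] at hz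
  have h1 := hσ.nonneg z
  have hzτ : z ∈ τ.support := Finsupp.mem_support_iff.2 fun h => by linarith
  exact lt_asymm hz2 (hyτ z hzτ)

theorem IsLowerPrincipal.even_structure (hab : a < b) (hlo : IsLowerPrincipal u a b (2 * k) c τ) :
    a ∉ τ.support ∧ τ.support.card = k := by
  have h := dblIndex_add_ends hab τ.support
  rw [(isPrincipal_iff.1 hlo.1).2, if_neg hlo.2] at h
  split_ifs at h with ha
  · omega
  · exact ⟨ha, by omega⟩

/-- Roots of the representation attached to a point to the left of the lower principal
representation of an even number of moments. -/
theorem IsCanonicalAt.even_structure (hab : a < b) (hu : IsCompleteChebyshevSet u a b K)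
    (hn : 2 * k ≤ K) (hσ : IsCanonicalAt u a b (2 * k) c ξ σ)
    (hlo : IsLowerPrincipal u a b (2 * k) c τ) (hξ : ∀ t ∈ τ.support, ξ < t) :
    b ∈ σ.support ∧ σ.support.card = k + 1 ∧ ∀ t ∈ σ.support, ξ ≤ t := by
  have hR := hσ.isRepresentation
  have hE := dblIndex_add_ends hab σ.support
  have hcτ := (hlo.even_structure hab).2
  have hN := hσ.dblIndex_cases
  have hU := Finset.card_union_le σ.support τ.support
  have hc1 : σ.support.card ≤ k + 1 := by split_ifs at hE <;> omega
  have hmin : ∀ t ∈ σ.support, ξ ≤ t := fun t ht => by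
    by_contra hlt
    exact hR.not_two_roots_below hu hn hlo.1.1 (by omega) ht hσ.1 (not_le.1 hlt) hξ
  -- Without `b`, a principal `σ` has `k` roots, like `τ`, and must equal it; a canonical `σ` has
  -- `a` as a root by parity, although its first root `ξ` is interior.
  have hb : b ∈ σ.support := by
    by_contra hb
    rw [if_neg hb] at hE
    rcases hN with hN | ⟨hN, hξI⟩
    · have : σ = τ := hR.eq_of_card_le hu hn hlo.1.1 (by split_ifs at hE <;> omega)
      exact lt_irrefl _ (hξ ξ (this ▸ hσ.1))
    · split_ifs at hE with ha
      · exact not_le.2 hξI.1 (hmin a ha)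
      · omega
  refine ⟨hb, ?_, hmin⟩
  rw [if_pos hb] at hE
  split_ifs at hE <;> omega

/-- Roots of the representation attached to a point to the left of the upper principal
representation of an odd number of moments. -/
theorem IsCanonicalAt.odd_structure (hab : a < b) (hu : IsCompleteChebyshevSet u a b K)
    (hn : 2 * k + 1 ≤ K) (hσ : IsCanonicalAt u a b (2 * k + 1) c ξ σ)
    (hup : IsUpperPrincipal u a b (2 * k + 1) c τ) (hξ : ∀ t ∈ τ.support, ξ < t) :
    b ∉ σ.support ∧ σ.support.card = k + 1 ∧ ∀ t ∈ σ.support, ξ ≤ t := by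
  have hR := hσ.isRepresentation
  have hE := dblIndex_add_ends hab σ.support
  have hEτ := dblIndex_add_ends hab τ.support
  rw [(isPrincipal_iff.1 hup.1).2, if_pos hup.2] at hEτ
  have hcτ : τ.support.card = k + 1 := by split_ifs at hEτ <;> omega
  have hN := hσ.dblIndex_cases
  have hU := Finset.card_union_add_card_inter σ.support τ.support
  -- If `b` is a root of `σ`, it is shared with `τ`; if not, parity and the index leave `σ` at most
  -- `k + 1` roots. Either way the union is small enough for alternation.
  have hc1 : (σ.support ∪ τ.support).card ≤ 2 * k + 1 + 1 := by
    by_cases hb : b ∈ σ.support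
    · have : 0 < (σ.support ∩ τ.support).card :=
        Finset.card_pos.2 ⟨b, Finset.mem_inter.2 ⟨hb, hup.2⟩⟩
      split_ifs at hE <;> omega
    · rw [if_neg hb] at hE
      split_ifs at hE <;> omega
  have hmin : ∀ t ∈ σ.support, ξ ≤ t := fun t ht => by
    by_contra hlt
    exact hR.not_two_roots_below hu hn hup.1.1 hc1 ht hσ.1 (not_le.1 hlt) hξ
  have hb : b ∉ σ.support := by
    intro hb
    rw [if_pos hb] at hE
    rcases hN with hN | ⟨hN, hξI⟩
    · have : σ = τ := IsUpperPrincipal.unique hab hu hn ⟨isPrincipal_iff.2 ⟨hR, hN⟩, hb⟩ hup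
      exact lt_irrefl _ (hξ ξ (this ▸ hσ.1))
    · split_ifs at hE with ha
      · exact not_le.2 hξI.1 (hmin a ha)
      · omega
  refine ⟨hb, ?_, hmin⟩
  rw [if_neg hb] at hE
  split_ifs at hE <;> omega

theorem exists_strictMono_image_eq {p : ℕ} {S : Finset ℝ} (h : S.card = p) :
    ∃ x : Fin p → ℝ, StrictMono x ∧ Finset.univ.image x = S :=
  ⟨S.orderEmbOfFin h, (S.orderEmbOfFin h).strictMono, S.image_orderEmbOfFin_univ h⟩

theorem StrictMono.apply_zero_eq {p : ℕ} {S : Finset ℝ} {x : Fin (p + 1) → ℝ} (hx : StrictMono x)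
    (h : Finset.univ.image x = S) (hξ : ξ ∈ S) (hmin : ∀ t ∈ S, ξ ≤ t) : x 0 = ξ := by
  rw [← h] at hξ hmin
  obtain ⟨i, -, rfl⟩ := Finset.mem_image.1 hξ
  exact le_antisymm (hx.monotone (Fin.zero_le i))
    (hmin _ (Finset.mem_image_of_mem _ (Finset.mem_univ _)))

theorem StrictMono.snoc {p : ℕ} {x : Fin p → ℝ} (hx : StrictMono x) {y : ℝ} (hy : ∀ i, x i < y) :
    StrictMono (Fin.snoc x y : Fin (p + 1) → ℝ) := by
  intro i j hij
  induction j using Fin.lastCases with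
  | last =>
    obtain ⟨i', rfl⟩ := Fin.exists_castSucc_eq.2 hij.ne
    simpa using hy i'
  | cast j =>
    obtain ⟨i', rfl⟩ := Fin.exists_castSucc_eq.2 (hij.trans (Fin.castSucc_lt_last j)).ne
    simpa using hx (Fin.castSucc_lt_castSucc_iff.1 hij)

theorem image_snoc {p : ℕ} (x : Fin p → ℝ) (y : ℝ) :
    Finset.univ.image (Fin.snoc x y : Fin (p + 1) → ℝ) = Finset.univ.image x ∪ {y} := by
  ext t
  simp only [Finset.mem_image, Finset.mem_univ, true_and, Finset.mem_union, Finset.mem_singleton]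
  constructor
  · rintro ⟨i, rfl⟩
    induction i using Fin.lastCases with
    | last => simp
    | cast i => simp
  · rintro (⟨i, rfl⟩ | rfl)
    · exact ⟨i.castSucc, by simp⟩
    · exact ⟨Fin.last p, by simp⟩

end structure_of_roots

/-! ### The two continuations -/

theorem mainTheorem1 (u : ℕ → ℝ → ℝ) (a b : ℝ) (hab : a < b) (k : ℕ) (hk : 0 < k)
    (hu : IsCompleteChebyshevSet u a b (2 * k + 2))
    (w : ℝ → ℝ) (hw : IntervalIntegrable w volume a b)
    (hwpos : ∀ᵐ t : ℝ, t ∈ Ioo a b → 0 < w t)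
    (c : ℕ → ℝ) (hc : c = weightMoment u a b w) :
    -- the `k`-point generalized Gauss rule
    ∃ t l : Fin k → ℝ, StrictMono t ∧ (∀ i, t i ∈ Ioo a b) ∧ (∀ i, 0 < l i) ∧
      (∀ σ, IsLowerPrincipal u a b (2 * k) c σ ↔ σ = discreteMeasure t l) ∧
    -- the continuation from the rule with the added point `b` of weight zero
    ∃ X L : ℝ → Fin (k + 1) → ℝ,
      X (t ⟨0, hk⟩) = Fin.snoc t b ∧ L (t ⟨0, hk⟩) = Fin.snoc l 0 ∧
      IsCanonicalFamily u a b (2 * k) c (t ⟨0, hk⟩) X L ∧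
      (∀ ξ ∈ Icc a (t ⟨0, hk⟩), X ξ (Fin.last k) = b) ∧
      (∀ ξ ∈ Ico a (t ⟨0, hk⟩), ∀ i, 0 < L ξ i) ∧
      (∀ i, i ≠ Fin.last k → StrictMonoOn (fun ξ => X ξ i) (Icc a (t ⟨0, hk⟩))) ∧
      -- the discrete moment of order `2 * k`
      (StrictAntiOn (fun ξ => quadSum (u (2 * k)) (X ξ) (L ξ)) (Icc a (t ⟨0, hk⟩)) ∨
        StrictMonoOn (fun ξ => quadSum (u (2 * k)) (X ξ) (L ξ)) (Icc a (t ⟨0, hk⟩))) ∧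
      (IsPositivelyOriented u a b (2 * k + 2) →
        StrictAntiOn (fun ξ => quadSum (u (2 * k)) (X ξ) (L ξ)) (Icc a (t ⟨0, hk⟩))) ∧
      (fun ξ => quadSum (u (2 * k)) (X ξ) (L ξ)) '' Icc a (t ⟨0, hk⟩) =
        momentRange u a b (2 * k) c ∧
      ∃ ξ₁ ∈ Ioo a (t ⟨0, hk⟩),
        (∀ ξ ∈ Icc a (t ⟨0, hk⟩), quadSum (u (2 * k)) (X ξ) (L ξ) = c (2 * k) ↔ ξ = ξ₁) ∧
        (∀ σ, IsUpperPrincipal u a b (2 * k + 1) c σ ↔ σ = discreteMeasure (X ξ₁) (L ξ₁)) ∧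
    -- the continuation from the upper principal representation
    ∃ Y M : ℝ → Fin (k + 1) → ℝ,
      Y ξ₁ = X ξ₁ ∧ M ξ₁ = L ξ₁ ∧
      IsCanonicalFamily u a b (2 * k + 1) c ξ₁ Y M ∧
      (∀ ξ ∈ Ico a ξ₁, Y ξ (Fin.last k) < b) ∧
      (∀ ξ ∈ Icc a ξ₁, ∀ i, 0 < M ξ i) ∧
      (∀ i, StrictMonoOn (fun ξ => Y ξ i) (Icc a ξ₁)) ∧
      -- the discrete moment of order `2 * k + 1`
      (StrictMonoOn (fun ξ => quadSum (u (2 * k + 1)) (Y ξ) (M ξ)) (Icc a ξ₁) ∨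
        StrictAntiOn (fun ξ => quadSum (u (2 * k + 1)) (Y ξ) (M ξ)) (Icc a ξ₁)) ∧
      (IsPositivelyOriented u a b (2 * k + 2) →
        StrictMonoOn (fun ξ => quadSum (u (2 * k + 1)) (Y ξ) (M ξ)) (Icc a ξ₁)) ∧
      (fun ξ => quadSum (u (2 * k + 1)) (Y ξ) (M ξ)) '' Icc a ξ₁ =
        momentRange u a b (2 * k + 1) c ∧
      ∃ ξ₂ ∈ Ioo a ξ₁,
        (∀ ξ ∈ Icc a ξ₁, quadSum (u (2 * k + 1)) (Y ξ) (M ξ) = c (2 * k + 1) ↔ ξ = ξ₂) ∧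
        -- the `(k + 1)`-point generalized Gauss rule
        (∀ σ, IsLowerPrincipal u a b (2 * k + 2) c σ ↔ σ = discreteMeasure (Y ξ₂) (M ξ₂)) ∧
        StrictMono (Y ξ₂) ∧ (∀ i, Y ξ₂ i ∈ Ioo a b) ∧ (∀ i, 0 < M ξ₂ i) ∧
        (∀ j < 2 * k + 2,
          quadSum (u j) (Y ξ₂) (M ξ₂) = ∫ s in a..b, u j s * w s) := by
  have hcp : HasPositiveMoments u a b (2 * k + 2) c := hc ▸
    hasPositiveMoments_weightMoment hab hu hw hwpos
  have hn0 : 0 < 2 * k := by omega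
  obtain ⟨lo, -, hlo, -⟩ := exists_lower_upper hab hu hcp hn0 (by omega)
  obtain ⟨haL, hcL⟩ := hlo.even_structure hab
  obtain ⟨t, ht, htimg⟩ := exists_strictMono_image_eq hcL
  have htmem : ∀ i, t i ∈ lo.support := fun i => by
    rw [← htimg]; exact Finset.mem_image_of_mem _ (Finset.mem_univ i)
  have htI : ∀ i, t i ∈ Ioo a b := fun i => by
    have := hlo.1.1.mem_Icc _ (htmem i)
    exact ⟨lt_of_le_of_ne this.1 fun h => haL (h ▸ htmem i),
      lt_of_le_of_ne this.2 fun h => hlo.2 (h ▸ htmem i)⟩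
  have hdm : discreteMeasure t (fun i => lo (t i)) = lo :=
    discreteMeasure_self ht.injective htimg.symm.subset
  refine ⟨t, fun i => lo (t i), ht, htI, fun i => hlo.1.1.pos _ (htmem i), fun σ => ?_, ?_⟩
  · rw [hdm]
    exact ⟨fun h => h.unique hab hu (by omega) hlo, fun h => h ▸ hlo⟩
  set t₁ := t ⟨0, hk⟩ with ht₁
  have hmin₁ : ∀ x ∈ lo.support, t₁ ≤ x := fun x hx => by
    rw [← htimg] at hx
    obtain ⟨i, -, rfl⟩ := Finset.mem_image.1 hx
    exact ht.monotone (Fin.mk_le_of_le_val (Nat.zero_le _))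
  have hat₁ : a < t₁ := (htI _).1
  have ht₁b : t₁ < b := (htI _).2
  have hloAt : IsCanonicalAt u a b (2 * k) c t₁ lo := ⟨htmem _, Or.inl hlo.1⟩
  -- The membership of `ξ` is put inside the existential, so that the choice is a total function of
  -- `ξ`.
  have hex : ∀ n, 0 < n → n ≤ 2 * k + 2 → ∀ ξ, ∃ σ, ξ ∈ Icc a b → IsCanonicalAt u a b n c ξ σ :=
    fun n h0 hn ξ => by
      by_cases hξ : ξ ∈ Icc a b
      · obtain ⟨σ, hσ⟩ := exists_isCanonicalAt hab hu hcp h0 hn hξ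
        exact ⟨σ, fun _ => hσ⟩
      · exact ⟨0, fun h => absurd h hξ⟩
  choose s hs using hex (2 * k) hn0 (by omega)
  have hs' : ∀ ξ ∈ Icc a t₁, IsCanonicalAt u a b (2 * k) c ξ (s ξ) := fun ξ hξ =>
    hs ξ ⟨hξ.1, hξ.2.trans ht₁b.le⟩
  have hst₁ : s t₁ = lo := (hs' t₁ ⟨hat₁.le, le_rfl⟩).unique hab hu (by omega) hloAt
  have hstr : ∀ ξ ∈ Ico a t₁, b ∈ (s ξ).support ∧ (s ξ).support.card = k + 1 ∧
      ∀ x ∈ (s ξ).support, ξ ≤ x := fun ξ hξ =>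
    (hs' ξ ⟨hξ.1, hξ.2.le⟩).even_structure hab hu (by omega) hlo
      fun x hx => hξ.2.trans_le (hmin₁ x hx)
  have hsb : ∀ ξ ∈ Ico a t₁, (s ξ).support ∪ {b} = (s ξ).support := fun ξ hξ =>
    Finset.union_eq_left.2 (Finset.singleton_subset_iff.2 (hstr ξ hξ).1)
  have hXex : ∀ ξ, ∃ x : Fin (k + 1) → ℝ, ξ ∈ Icc a t₁ →
      StrictMono x ∧ Finset.univ.image x = (s ξ).support ∪ {b} := by
    intro ξ
    by_cases hξ : ξ ∈ Icc a t₁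
    · have hcard : ((s ξ).support ∪ {b}).card = k + 1 := by
        rcases hξ.2.eq_or_lt with h | h
        · rw [h, hst₁, Finset.card_union_of_disjoint (Finset.disjoint_singleton_right.2 hlo.2),
            hcL, Finset.card_singleton]
        · rw [hsb ξ ⟨hξ.1, h⟩, (hstr ξ ⟨hξ.1, h⟩).2.1]
      obtain ⟨x, hx⟩ := exists_strictMono_image_eq hcard
      exact ⟨x, fun _ => hx⟩
    · exact ⟨0, fun h => absurd h hξ⟩
  choose X hX using hXex
  -- Adding `{b}` keeps the number of nodes equal to `k + 1` also at `t₁`, where `b` carries no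
  -- mass.
  have hsel : IsCanonicalSelection u a b (2 * k) c t₁ {b} s X :=
    { isCanonicalAt := hs'
      strictMono := fun ξ hξ => (hX ξ hξ).1
      first := fun ξ hξ => by
        refine (hX ξ hξ).1.apply_zero_eq (hX ξ hξ).2
          (Finset.mem_union_left _ (hs' ξ hξ).1) fun x hx => ?_
        rcases Finset.mem_union.1 hx with hx | hx
        · rcases hξ.2.eq_or_lt with h | h
          · rw [h, hst₁] at hx
            exact h ▸ hmin₁ x hx
          · exact (hstr ξ ⟨hξ.1, h⟩).2.2 x hx
        · rw [Finset.mem_singleton.1 hx]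
          exact hξ.2.trans ht₁b.le
      image_eq := fun ξ hξ => (hX ξ hξ).2
      subset_singleton := subset_rfl
      le_card := by simp }
  have haI : a ∈ Icc a t₁ := ⟨le_rfl, hat₁.le⟩
  have ht₁I : t₁ ∈ Icc a t₁ := ⟨hat₁.le, le_rfl⟩
  have hXt₁ : X t₁ = Fin.snoc t b := by
    refine (hX t₁ ht₁I).1.eq_of_image_eq (ht.snoc fun i => (htI i).2) ?_
    rw [(hX t₁ ht₁I).2, image_snoc, htimg, hst₁]
  have hXlast : ∀ ξ ∈ Icc a t₁, X ξ (Fin.last k) = b := fun ξ hξ =>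
    hsel.last_eq hab hξ (Finset.mem_singleton_self b)
  have hLpos : ∀ ξ ∈ Ico a t₁, ∀ i, 0 < s ξ (X ξ i) := fun ξ hξ i => by
    have hξ' : ξ ∈ Icc a t₁ := ⟨hξ.1, hξ.2.le⟩
    refine (hs' ξ hξ').isRepresentation.pos _ ?_
    rw [← hsb ξ hξ, ← (hX ξ hξ').2]
    exact Finset.mem_image_of_mem _ (Finset.mem_univ i)
  -- An endpoint admits no canonical alternative, so the representation attached to `a` is
  -- principal, and it involves `b`.
  have hupa : IsUpperPrincipal u a b (2 * k) c (s a) :=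
    ⟨(hs' a haI).2.resolve_right fun h => lt_irrefl _ h.2.1, (hstr a ⟨le_rfl, hat₁⟩).1⟩
  obtain ⟨himg₁, ξ₁, hξ₁, hξ₁u⟩ := hsel.image_eq_and_exists_unique hab hat₁ hu hcp (by omega) hn0
    hk (Or.inl ⟨hupa, hst₁.symm ▸ hlo⟩)
  have hξ₁I : ξ₁ ∈ Icc a t₁ := Ioo_subset_Icc_self hξ₁
  refine ⟨X, fun ξ i => s ξ (X ξ i), hXt₁, ?_, hsel.isCanonicalFamily hab hu (by omega) hn0 hk,
    hXlast, hLpos, ?_, hsel.strictAntiOn_or_strictMonoOn hab hu (by omega), ?_, himg₁, ξ₁, hξ₁,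
    hξ₁u, ?_⟩
  · funext i
    beta_reduce
    rw [hXt₁, hst₁]
    induction i using Fin.lastCases with
    | last => simpa using hlo.2
    | cast i => simp
  · intro i hi ξ hξ ξ' hξ' hlt
    refine hsel.point_lt hab hu (by omega) hξ hξ' hlt i fun h => ?_
    rw [Finset.mem_singleton, ← hXlast ξ' hξ'] at h
    exact hi ((hX ξ' hξ').1.injective h)
  · intro hpos ξ hξ ξ' hξ' hlt
    have := hsel.moment_sign_of_isPositivelyOriented hab hu (by omega) hpos hξ hξ' hlt
    rw [pow_mul] at this
    simp only [even_two, Even.neg_pow, one_pow, one_mul] at this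
    exact sub_pos.1 this
  set up := s ξ₁ with hup
  obtain ⟨hbup, hcup, hminup⟩ := hstr ξ₁ ⟨hξ₁.1.le, hξ₁.2⟩
  have hupR : IsRepresentation u a b (2 * k + 1) c up := by
    have h := (hs' ξ₁ hξ₁I).isRepresentation
    refine ⟨h.mem_Icc, h.pos, fun j hj => ?_⟩
    rcases Nat.lt_succ_iff_lt_or_eq.1 hj with hj | rfl
    · exact h.moment j hj
    · exact (hsel.quadSum_eq hξ₁I _).symm.trans ((hξ₁u ξ₁ hξ₁I).2 rfl)
  -- There are `k + 1` roots including `b` but not `a`, so the doubled index is `2 * k + 1`.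
  have hupP : IsUpperPrincipal u a b (2 * k + 1) c up := by
    refine ⟨isPrincipal_iff.2 ⟨hupR, ?_⟩, hbup⟩
    have h := dblIndex_add_ends hab up.support
    rw [if_neg fun ha => not_le.2 hξ₁.1 (hminup a ha), if_pos hbup, hcup] at h
    omega
  have hdm₁ : discreteMeasure (X ξ₁) (fun i => s ξ₁ (X ξ₁ i)) = up := hsel.discreteMeasure_eq hξ₁I
  refine ⟨fun σ => ?_, ?_⟩
  · rw [hdm₁]
    exact ⟨fun h => h.unique hab hu (by omega) hupP, fun h => h ▸ hupP⟩
  have hm0 : 0 < 2 * k + 1 := by omega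
  have hξ₁b : ξ₁ < b := hξ₁.2.trans ht₁b
  choose r hr using hex (2 * k + 1) hm0 (by omega)
  have hr' : ∀ ξ ∈ Icc a ξ₁, IsCanonicalAt u a b (2 * k + 1) c ξ (r ξ) := fun ξ hξ =>
    hr ξ ⟨hξ.1, hξ.2.trans hξ₁b.le⟩
  have haI' : a ∈ Icc a ξ₁ := ⟨le_rfl, hξ₁.1.le⟩
  have hξ₁I' : ξ₁ ∈ Icc a ξ₁ := ⟨hξ₁.1.le, le_rfl⟩
  -- The representation reached at `ξ₁` is attached to `ξ₁` also for the longer moment vector, so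
  -- the second family starts from it.
  have hrξ₁ : r ξ₁ = up := (hr' ξ₁ hξ₁I').unique hab hu (by omega)
    ⟨(hs' ξ₁ hξ₁I).1, Or.inl hupP.1⟩
  have hrstr : ∀ ξ ∈ Ico a ξ₁, b ∉ (r ξ).support ∧ (r ξ).support.card = k + 1 ∧
      ∀ x ∈ (r ξ).support, ξ ≤ x := fun ξ hξ =>
    (hr' ξ ⟨hξ.1, hξ.2.le⟩).odd_structure hab hu (by omega) hupP
      fun x hx => hξ.2.trans_le (hminup x hx)
  have hrcard : ∀ ξ ∈ Icc a ξ₁, (r ξ).support.card = k + 1 ∧ ∀ x ∈ (r ξ).support, ξ ≤ x := by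
    intro ξ hξ
    rcases hξ.2.eq_or_lt with h | h
    · rw [h, hrξ₁]
      exact ⟨hcup, hminup⟩
    · exact (hrstr ξ ⟨hξ.1, h⟩).2
  have hYex : ∀ ξ, ∃ y : Fin (k + 1) → ℝ, ξ ∈ Icc a ξ₁ →
      StrictMono y ∧ Finset.univ.image y = (r ξ).support := by
    intro ξ
    by_cases hξ : ξ ∈ Icc a ξ₁
    · obtain ⟨y, hy⟩ := exists_strictMono_image_eq (hrcard ξ hξ).1
      exact ⟨y, fun _ => hy⟩
    · exact ⟨0, fun h => absurd h hξ⟩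
  choose Y hY using hYex
  have hsel' : IsCanonicalSelection u a b (2 * k + 1) c ξ₁ ∅ r Y :=
    { isCanonicalAt := hr'
      strictMono := fun ξ hξ => (hY ξ hξ).1
      first := fun ξ hξ => (hY ξ hξ).1.apply_zero_eq (hY ξ hξ).2 (hr' ξ hξ).1 (hrcard ξ hξ).2
      image_eq := fun ξ hξ => by rw [(hY ξ hξ).2, Finset.union_empty]
      subset_singleton := Finset.empty_subset _
      le_card := by simp }
  have hYmem : ∀ ξ ∈ Icc a ξ₁, ∀ i, Y ξ i ∈ (r ξ).support := fun ξ hξ i => by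
    rw [← (hY ξ hξ).2]
    exact Finset.mem_image_of_mem _ (Finset.mem_univ i)
  have hYξ₁ : Y ξ₁ = X ξ₁ := by
    refine (hY ξ₁ hξ₁I').1.eq_of_image_eq (hX ξ₁ hξ₁I).1 ?_
    rw [(hY ξ₁ hξ₁I').2, (hX ξ₁ hξ₁I).2, hsb ξ₁ ⟨hξ₁.1.le, hξ₁.2⟩, hrξ₁]
  have hYlt : ∀ ξ ∈ Ico a ξ₁, ∀ i, Y ξ i < b := fun ξ hξ i => by
    have hξ' : ξ ∈ Icc a ξ₁ := ⟨hξ.1, hξ.2.le⟩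
    exact lt_of_le_of_ne ((hr' ξ hξ').isRepresentation.mem_Icc _ (hYmem ξ hξ' i)).2
      fun h => (hrstr ξ hξ).1 (h ▸ hYmem ξ hξ' i)
  have hMpos : ∀ ξ ∈ Icc a ξ₁, ∀ i, 0 < r ξ (Y ξ i) := fun ξ hξ i =>
    (hr' ξ hξ).isRepresentation.pos _ (hYmem ξ hξ i)
  -- At `a` the representation is again principal, but for an odd number of moments `b` has been
  -- left, so it is the lower one.
  have hloa : IsLowerPrincipal u a b (2 * k + 1) c (r a) :=
    ⟨(hr' a haI').2.resolve_right fun h => lt_irrefl _ h.2.1, (hrstr a ⟨le_rfl, hξ₁.1⟩).1⟩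
  obtain ⟨himg₂, ξ₂, hξ₂, hξ₂u⟩ := hsel'.image_eq_and_exists_unique hab hξ₁.1 hu hcp le_rfl hm0
    hk (Or.inr ⟨hloa, hrξ₁.symm ▸ hupP⟩)
  have hξ₂I : ξ₂ ∈ Icc a ξ₁ := Ioo_subset_Icc_self hξ₂
  have hgR : IsRepresentation u a b (2 * k + 2) c (r ξ₂) := by
    have h := (hr' ξ₂ hξ₂I).isRepresentation
    refine ⟨h.mem_Icc, h.pos, fun j hj => ?_⟩
    rcases Nat.lt_succ_iff_lt_or_eq.1 hj with hj | rfl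
    · exact h.moment j hj
    · exact (hsel'.quadSum_eq hξ₂I _).symm.trans ((hξ₂u ξ₂ hξ₂I).2 rfl)
  obtain ⟨hbg, hcg, hming⟩ := hrstr ξ₂ ⟨hξ₂.1.le, hξ₂.2⟩
  -- Now neither endpoint is a root, so the `k + 1` roots give doubled index `2 * k + 2`.
  have hgP : IsLowerPrincipal u a b (2 * k + 2) c (r ξ₂) := by
    refine ⟨isPrincipal_iff.2 ⟨hgR, ?_⟩, hbg⟩
    have h := dblIndex_add_ends hab (r ξ₂).support
    rw [if_neg fun ha => not_le.2 hξ₂.1 (hming a ha), if_neg hbg, hcg] at h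
    omega
  have hdm₂ : discreteMeasure (Y ξ₂) (fun i => r ξ₂ (Y ξ₂ i)) = r ξ₂ :=
    hsel'.discreteMeasure_eq hξ₂I
  refine ⟨Y, fun ξ i => r ξ (Y ξ i), hYξ₁, ?_, hsel'.isCanonicalFamily hab hu (by omega) hm0 hk,
    fun ξ hξ => hYlt ξ hξ _, hMpos, ?_, (hsel'.strictAntiOn_or_strictMonoOn hab hu le_rfl).symm,
    ?_, himg₂, ξ₂, hξ₂, hξ₂u, fun σ => ?_, (hY ξ₂ hξ₂I).1, fun i => ⟨?_, ?_⟩, hMpos ξ₂ hξ₂I, ?_⟩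
  · funext i
    beta_reduce
    rw [hYξ₁, hrξ₁]
  · intro i ξ hξ ξ' hξ' hlt
    exact hsel'.point_lt hab hu (by omega) hξ hξ' hlt i (Finset.notMem_empty _)
  · intro hpos ξ hξ ξ' hξ' hlt
    have := hsel'.moment_sign_of_isPositivelyOriented hab hu le_rfl hpos hξ hξ' hlt
    rw [pow_succ, pow_mul] at this
    simp only [even_two, Even.neg_pow, one_pow, one_mul, neg_mul] at this
    simp only
    linarith
  · rw [hdm₂]
    exact ⟨fun h => h.unique hab hu le_rfl hgP, fun h => h ▸ hgP⟩
  · exact hξ₂.1.trans_le (hming _ (hYmem ξ₂ hξ₂I i))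
  · exact hYlt ξ₂ ⟨hξ₂.1.le, hξ₂.2⟩ i
  · intro j hj
    rw [hsel'.quadSum_eq hξ₂I]
    exact (hgR.moment j hj).trans (by rw [hc]; rfl)
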